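/- Let $\mathcal F$ be a field and let $p\ge 1$ be an integer. **Symmetric self-adjunctions.** A symmetric self-adjunction on a category $\mathcal A$ consists of an endofunctor $F$ of $\mathcal A$, natural transformations $\varphi:FF\to 1_{\mathcal A}$ and $\gamma:1_{\mathcal A}\to FF$ that satisfy the triangular equations $\varphi_{FA}\circ F\gamma_A=1_{FA}=F\varphi_A\circ\gamma_{FA}$, and a natural transformation $\chi:FF\to FF$ with $$\chi_A\circ\chi_A=1,\quad \chi_{FA}\circ F\chi_A\circ\chi_{FA}=F\chi_A\circ\chi_{FA}\circ F\chi_A,\quad \varphi_A\circ\chi_A=\varphi_A,\quad \chi_A\circ\gamma_A=\gamma_A,$$ $$\varphi_{FA}\circ F\chi_A=F\varphi_A\circ\chi_{FA},\qquad \chi_{FA}\circ F\gamma_A=F\chi_A\circ\gamma_{FA}.$$ A functor between categories with symmetric self-adjunctions is *strict* if it commutes with the endofunctors and sends $\varphi,\gamma,\chi$ to $\varphi,\gamma,\chi$ on the nose. Let $\mathcal K$ be the category of the symmetric self-adjunction freely generated by a single object. **Diagrams.** An $m$-$n$-diagram has $m$ vertices in a top row and $n$ vertices in a bottom row, each of the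 $m+n$ vertices being joined by a thread to exactly one other vertex; $n$-$n$-diagrams are called $n$-diagrams. In the category $\mathit{Br}_p$ the objects are the natural numbers, and the arrows $m\to n$ are the $m$-$n$-diagrams with a coefficient $p^k$ ($k\ge 0$); the composite $D_2\circ D_1$ of an $m$-$n$-diagram $D_1$ and an $n$-$q$-diagram $D_2$ is obtained by gluing the bottom row of $D_1$ to the top row of $D_2$, concatenating threads, and replacing each circular component by a factor $p$. Adding a vertical thread on the left, together with the evident cap, cup and crossing of the first two vertices, makes $\mathit{Br}_p$ a category with a symmetric self-adjunction. Let $\Lambda:\mathcal K\to\mathit{Br}_p$ be the unique strict functor that sends the generator to $0$. Brauer's algebra $B_n$ is the $\mathcal F$-algebra with basis the $n$-diagrams and with this composition (extended bilinearly) as multiplication. **Matrices.** In $\mathbf{Mat}_{\mathcal F}$ the objects are the natural numbers, an arrow $m\to n$ is an $n\times m$ matrix over $\mathcal F$, and composition is matrix multiplication. The functor $p\otimes\_$ sends $n$ to $pn$ and $M$ to the Kronecker product $I_p\otimes M$. With the rows or columns numbered by $\{1,\dots,p^2n\}$ indexed lexicographically by triples $(a,b,i)\in\{1,\dots,p\}^2\times\{1,\dots,n\}$,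 let $\varphi_n$ be the $n\times p^2n$ matrix with entry $\delta_{ab}\delta_{ij}$ in row $j$ and column $(a,b,i)$, let $\gamma_n=\varphi_n^{T}$, and let $\chi_n$ be the permutation matrix that exchanges $a$ and $b$. Then $\langle\mathbf{Mat}_{\mathcal F},p\otimes\_,\varphi,\gamma,\chi\rangle$ is a symmetric self-adjunction. Let $\bar R:\mathcal K\to\mathbf{Mat}_{\mathcal F}$ be the unique strict functor that sends the generator to $1$. **Brauer's matrices.** Identify $\{1,\dots,p^n\}$ with the set of sequences $\{1,\dots,n\}\to\{1,\dots,p\}$ in lexicographic order. To an $n$-diagram $D$ and vectors $u^1,\dots,u^n,v^1,\dots,v^n\in\mathcal F^p$, attached to the vertices of the top and of the bottom row, associate the product, over the threads of $D$, of the scalar products of the two vectors at the ends of the thread. Brauer's matrix $b^D=[b^D_{i,j}]_{p^n\times p^n}$ has $b^D_{i,j}=1$ if the labelling of the top vertices by $i(1),\dots,i(n)$ and of the bottom vertices by $j(1),\dots,j(n)$ gives equal labels to linked vertices, and $b^D_{i,j}=0$ otherwise. **Claim.** 1. If $p\ge 2$, then $\Lambda$ is an isomorphism of categories. 2. There is exactly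 one functor $R:\mathit{Br}_p\to\mathbf{Mat}_{\mathcal F}$ with $R\circ\Lambda=\bar R$; so $R$ is the composite $\bar R\circ\Lambda^{-1}$ if $p\ge2$. It maps the object $n$ to $p^n$. 3. $R(D_2\circ D_1)=R(D_2)\cdot R(D_1)$ for every $m$-$n$-diagram $D_1$ and every $n$-$q$-diagram $D_2$, and $R(p^k\cdot D)=p^k\cdot R(D)$ for every $m$-$n$-diagram $D$ and every $k\ge0$. 4. For every $n$-diagram $D$, $b^D$ is the only matrix $[b_{i,j}]$ over $\mathcal F$ such that for all vectors the product of scalar products associated with $D$ is equal to $\sum_{1\le i,j\le p^n}b_{i,j}\,u^1_{i(1)}\cdots u^n_{i(n)}\,v^1_{j(1)}\cdots v^n_{j(n)}$, and $R(D)$ coincides with Brauer's matrix, with columns indexed by the top row and rows by the bottom row: the entry of $R(D)$ in row $j$ and column $i$ is $b^D_{i,j}$, i.e. $R(D)=(b^D)^{T}$. 5. For every $n$, there is a homomorphism of $\mathcal F$-algebras from $B_n$ to the algebra of $p^n\times p^n$ matrices that maps every $n$-diagram $D$ to $R(D)$, and it coincides (with the same indexing of rows and columns) with the linear extension of $D\mapsto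 b^D$ to $B_n$. -/

import Mathlib

open CategoryTheory

universe u v w v'

namespace BrauerRep

/-! ### Symmetric self-adjunctions -/

/-- A symmetric self-adjunction on a category `A`: an endofunctor `F` which is adjoint to itself,
with counit `φ : F F ⟶ 1` and unit `γ : 1 ⟶ F F` (the fields `adj.counit` and `adj.unit`; the
triangular equations are part of `F ⊣ F`), together with a natural transformation
`χ : F F ⟶ F F` subject to six equations.  Recall that `f ≫ g` is `g ∘ f`. -/
structure SymSelfAdj (A : Type u) [Category.{v} A] where
  F : A ⥤ A
  adj : F ⊣ F
  χ : F ⋙ F ⟶ F ⋙ F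
  χ_χ : ∀ a, χ.app a ≫ χ.app a = 𝟙 (F.obj (F.obj a))
  braid : ∀ a, χ.app (F.obj a) ≫ F.map (χ.app a) ≫ χ.app (F.obj a) =
    F.map (χ.app a) ≫ χ.app (F.obj a) ≫ F.map (χ.app a)
  χ_φ : ∀ a, χ.app a ≫ adj.counit.app a = adj.counit.app a
  γ_χ : ∀ a, adj.unit.app a ≫ χ.app a = adj.unit.app a
  χ_φ_slide : ∀ a, F.map (χ.app a) ≫ adj.counit.app (F.obj a) =
    χ.app (F.obj a) ≫ F.map (adj.counit.app a)
  γ_χ_slide : ∀ a, F.map (adj.unit.app a) ≫ χ.app (F.obj a) =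
    adj.unit.app (F.obj a) ≫ F.map (χ.app a)

/-- The functor `H` strictly preserves the structure of symmetric self-adjunction: it commutes
with the two endofunctors on the nose, and it sends `φ`, `γ`, `χ` to `φ`, `γ`, `χ`.  In the last
three clauses the two sides have the same source and target because of the first one, so `HEq`
is plain equality of arrows up to these equalities of objects. -/
structure IsStrict {A : Type u} [Category.{v} A] {B : Type w} [Category.{v'} B]
    (S : SymSelfAdj A) (T : SymSelfAdj B) (H : A ⥤ B) : Prop where
  comm : S.F ⋙ H = H ⋙ T.F
  map_φ : ∀ a, HEq (H.map (S.adj.counit.app a)) (T.adj.counit.app (H.obj a))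
  map_γ : ∀ a, HEq (H.map (S.adj.unit.app a)) (T.adj.unit.app (H.obj a))
  map_χ : ∀ a, HEq (H.map (S.χ.app a)) (T.χ.app (H.obj a))

/-! ### The symmetric self-adjunction freely generated by a single object -/

/-- Objects of the free symmetric self-adjunction: `gen`, `F gen`, `F F gen`, … -/
inductive FreeSSA : Type
  | gen : FreeSSA
  | app : FreeSSA → FreeSSA

namespace FreeSSA

/-- Arrow terms. -/
inductive Term : FreeSSA → FreeSSA → Type
  | id (a : FreeSSA) : Term a a
  | comp {a b c : FreeSSA} (f : Term a b) (g : Term b c) : Term a c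
  | map {a b : FreeSSA} (f : Term a b) : Term a.app b.app
  | φ (a : FreeSSA) : Term a.app.app a
  | γ (a : FreeSSA) : Term a a.app.app
  | χ (a : FreeSSA) : Term a.app.app a.app.app

open Term in
/-- The congruence on arrow terms generated by the equations of symmetric self-adjunctions
(`comp f g` is `g ∘ f`). -/
inductive Rel : ∀ {a b : FreeSSA}, Term a b → Term a b → Prop
  | refl {a b : FreeSSA} (f : Term a b) : Rel f f
  | symm {a b : FreeSSA} {f g : Term a b} : Rel f g → Rel g f
  | trans {a b : FreeSSA} {f g h : Term a b} : Rel f g → Rel g h → Rel f h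
  | comp_congr {a b c : FreeSSA} {f f' : Term a b} {g g' : Term b c} :
      Rel f f' → Rel g g' → Rel (comp f g) (comp f' g')
  | map_congr {a b : FreeSSA} {f f' : Term a b} : Rel f f' → Rel (map f) (map f')
  | id_comp {a b : FreeSSA} (f : Term a b) : Rel (comp (id a) f) f
  | comp_id {a b : FreeSSA} (f : Term a b) : Rel (comp f (id b)) f
  | assoc {a b c d : FreeSSA} (f : Term a b) (g : Term b c) (h : Term c d) :
      Rel (comp (comp f g) h) (comp f (comp g h))
  | map_id (a : FreeSSA) : Rel (map (id a)) (id a.app)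
  | map_comp {a b c : FreeSSA} (f : Term a b) (g : Term b c) :
      Rel (map (comp f g)) (comp (map f) (map g))
  | φ_nat {a b : FreeSSA} (f : Term a b) : Rel (comp (map (map f)) (φ b)) (comp (φ a) f)
  | γ_nat {a b : FreeSSA} (f : Term a b) : Rel (comp f (γ b)) (comp (γ a) (map (map f)))
  | χ_nat {a b : FreeSSA} (f : Term a b) :
      Rel (comp (map (map f)) (χ b)) (comp (χ a) (map (map f)))
  | left_triangle (a : FreeSSA) : Rel (comp (map (γ a)) (φ a.app)) (id a.app)
  | right_triangle (a : FreeSSA) : Rel (comp (γ a.app) (map (φ a))) (id a.app)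
  | χ_χ (a : FreeSSA) : Rel (comp (χ a) (χ a)) (id a.app.app)
  | braid (a : FreeSSA) : Rel (comp (χ a.app) (comp (map (χ a)) (χ a.app)))
      (comp (map (χ a)) (comp (χ a.app) (map (χ a))))
  | χ_φ (a : FreeSSA) : Rel (comp (χ a) (φ a)) (φ a)
  | γ_χ (a : FreeSSA) : Rel (comp (γ a) (χ a)) (γ a)
  | χ_φ_slide (a : FreeSSA) :
      Rel (comp (map (χ a)) (φ a.app)) (comp (χ a.app) (map (φ a)))
  | γ_χ_slide (a : FreeSSA) :
      Rel (comp (map (γ a)) (χ a.app)) (comp (γ a.app) (map (χ a)))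

instance termSetoid (a b : FreeSSA) : Setoid (Term a b) where
  r := Rel
  iseqv := ⟨Rel.refl, Rel.symm, Rel.trans⟩

/-- The category of the free symmetric self-adjunction on one object: arrows are arrow terms
modulo the equations. -/
instance : Category.{0} FreeSSA where
  Hom a b := Quotient (termSetoid a b)
  id a := ⟦Term.id a⟧
  comp := Quotient.map₂ Term.comp fun _ _ h _ _ h' => Rel.comp_congr h h'
  id_comp := by rintro a b ⟨f⟩; exact Quotient.sound (Rel.id_comp f)
  comp_id := by rintro a b ⟨f⟩; exact Quotient.sound (Rel.comp_id f)
  assoc := by rintro a b c d ⟨f⟩ ⟨g⟩ ⟨h⟩; exact Quotient.sound (Rel.assoc f g h)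

/-- The endofunctor of the free symmetric self-adjunction. -/
def functor : FreeSSA ⥤ FreeSSA where
  obj := app
  map := Quotient.map Term.map fun _ _ h => Rel.map_congr h
  map_id a := Quotient.sound (Rel.map_id a)
  map_comp := by rintro a b c ⟨f⟩ ⟨g⟩; exact Quotient.sound (Rel.map_comp f g)

/-- The free symmetric self-adjunction. -/
def ssa : SymSelfAdj FreeSSA where
  F := functor
  adj :=
    { unit :=
        { app := fun a => ⟦Term.γ a⟧
          naturality := by rintro a b ⟨f⟩; exact Quotient.sound (Rel.γ_nat f) }
      counit :=
        { app := fun a => ⟦Term.φ a⟧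
          naturality := by rintro a b ⟨f⟩; exact Quotient.sound (Rel.φ_nat f) }
      left_triangle_components := fun a => Quotient.sound (Rel.left_triangle a)
      right_triangle_components := fun a => Quotient.sound (Rel.right_triangle a) }
  χ :=
    { app := fun a => ⟦Term.χ a⟧
      naturality := by rintro a b ⟨f⟩; exact Quotient.sound (Rel.χ_nat f) }
  χ_χ a := Quotient.sound (Rel.χ_χ a)
  braid a := Quotient.sound (Rel.braid a)
  χ_φ a := Quotient.sound (Rel.χ_φ a)
  γ_χ a := Quotient.sound (Rel.γ_χ a)
  χ_φ_slide a := Quotient.sound (Rel.χ_φ_slide a)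
  γ_χ_slide a := Quotient.sound (Rel.γ_χ_slide a)

section Lift

variable {B : Type w} [Category.{v} B] (T : SymSelfAdj B) (b : B)

/-- Interpretation of objects. -/
def interpObj : FreeSSA → B
  | gen => b
  | app a => T.F.obj (interpObj a)

/-- Interpretation of arrow terms. -/
def interp : ∀ {x y : FreeSSA}, Term x y → (interpObj T b x ⟶ interpObj T b y)
  | _, _, .id _ => 𝟙 _
  | _, _, .comp f g => interp f ≫ interp g
  | _, _, .map f => T.F.map (interp f)
  | _, _, .φ a => T.adj.counit.app (interpObj T b a)
  | _, _, .γ a => T.adj.unit.app (interpObj T b a)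
  | _, _, .χ a => T.χ.app (interpObj T b a)

theorem interp_rel {x y : FreeSSA} {f g : Term x y} (h : Rel f g) :
    interp T b f = interp T b g := by
  induction h with
  | refl => rfl
  | symm _ ih => exact ih.symm
  | trans _ _ ih ih' => exact ih.trans ih'
  | comp_congr _ _ ih ih' => simp only [interp, ih, ih']
  | map_congr _ ih => exact congrArg (fun f => T.F.map f) ih
  | id_comp => exact Category.id_comp _
  | comp_id => exact Category.comp_id _
  | assoc => exact Category.assoc _ _ _
  | map_id => exact T.F.map_id _
  | map_comp => exact T.F.map_comp _ _
  | φ_nat f => exact T.adj.counit.naturality (interp T b f)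
  | γ_nat f => exact T.adj.unit.naturality (interp T b f)
  | χ_nat f => exact T.χ.naturality (interp T b f)
  | left_triangle => exact T.adj.left_triangle_components _
  | right_triangle => exact T.adj.right_triangle_components _
  | χ_χ => exact T.χ_χ _
  | braid => exact T.braid _
  | χ_φ => exact T.χ_φ _
  | γ_χ => exact T.γ_χ _
  | χ_φ_slide => exact T.χ_φ_slide _
  | γ_χ_slide => exact T.γ_χ_slide _

/-- The functor given by freeness: it strictly preserves the structure and sends the generator
to `b`.  By `existsUnique_strict` it is the only one. -/
def lift : FreeSSA ⥤ B where
  obj := interpObj T b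
  map := Quotient.lift (interp T b) fun _ _ h => interp_rel T b h
  map_id _ := rfl
  map_comp := by rintro x y z ⟨f⟩ ⟨g⟩; rfl

theorem lift_comm : ssa.F ⋙ lift T b = lift T b ⋙ T.F :=
  CategoryTheory.Functor.hext (fun _ => rfl) (by rintro x y ⟨f⟩; rfl)

theorem heq_comp {x x' y y' z z' : B} (hx : x = x') (hy : y = y') (hz : z = z') {f : x ⟶ y}
    {f' : x' ⟶ y'} {g : y ⟶ z} {g' : y' ⟶ z'} (hf : HEq f f') (hg : HEq g g') :
    HEq (f ≫ g) (f' ≫ g') := by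
  subst hx hy hz; cases hf; cases hg; rfl

theorem heq_map {x x' y y' : B} (hx : x = x') (hy : y = y') {f : x ⟶ y}
    {f' : x' ⟶ y'} (hf : HEq f f') : HEq (T.F.map f) (T.F.map f') := by
  subst hx hy; cases hf; rfl

theorem lift_isStrict : IsStrict ssa T (lift T b) where
  comm := lift_comm T b
  map_φ _ := HEq.rfl
  map_γ _ := HEq.rfl
  map_χ _ := HEq.rfl

theorem eq_lift (H : FreeSSA ⥤ B) (hH : IsStrict ssa T H) (hb : H.obj gen = b) : H = lift T b := by
  have hobj : ∀ x, H.obj x = interpObj T b x := by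
    intro x
    induction x with
    | gen => exact hb
    | app a ih => exact (Functor.congr_obj hH.comm a).trans (congrArg T.F.obj ih)
  refine CategoryTheory.Functor.hext hobj ?_
  suffices key : ∀ {x y : FreeSSA} (f : Term x y), HEq (H.map ⟦f⟧) (interp T b f) by
    rintro x y ⟨f⟩
    exact key f
  have hφ : ∀ {a a' : B}, a = a' → HEq (T.adj.counit.app a) (T.adj.counit.app a') := by
    rintro a _ rfl; rfl
  have hγ : ∀ {a a' : B}, a = a' → HEq (T.adj.unit.app a) (T.adj.unit.app a') := by
    rintro a _ rfl; rfl
  have hχ : ∀ {a a' : B}, a = a' → HEq (T.χ.app a) (T.χ.app a') := by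
    rintro a _ rfl; rfl
  have hid : ∀ {a a' : B}, a = a' → HEq (𝟙 a) (𝟙 a') := by
    rintro a _ rfl; rfl
  intro x y f
  induction f with
  | id a => exact (heq_of_eq (H.map_id a)).trans (hid (hobj a))
  | comp f g ihf ihg =>
    exact (heq_of_eq (H.map_comp (X := _) ⟦f⟧ ⟦g⟧)).trans
      (heq_comp (hobj _) (hobj _) (hobj _) ihf ihg)
  | map f ih =>
    exact (Functor.hcongr_hom hH.comm (X := _) ⟦f⟧).trans (heq_map T (hobj _) (hobj _) ih)
  | φ a => exact (hH.map_φ a).trans (hφ (hobj a))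
  | γ a => exact (hH.map_γ a).trans (hγ (hobj a))
  | χ a => exact (hH.map_χ a).trans (hχ (hobj a))

/-- The universal property: `FreeSSA` is freely generated by `gen`. -/
theorem existsUnique_strict : ∃! H : FreeSSA ⥤ B, IsStrict ssa T H ∧ H.obj gen = b :=
  ⟨lift T b, ⟨lift_isStrict T b, rfl⟩, fun H hH => eq_lift T b H hH.1 hH.2⟩

end Lift

end FreeSSA

/-! ### Cup, cap and swap matrices

The index sets are a family `X o` with `X (s o) ≃ Q × X o`; so an element of `X (s (s o))` amounts
to a triple `(a, b, x)` with `a b : Q` and `x : X o`.  In terms of the Kronecker delta the matrices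
below are `pad M (a, j) (b, i) = δ a b * M j i`, `cap j (a, b, i) = δ a b * δ i j`,
`cup (a, b, j) i = δ a b * δ j i` and `swap (a, b, j) (a', b', i) = δ a b' * δ b a' * δ j i`. -/

section
set_option linter.unusedSectionVars false
variable {R : Type*} [CommSemiring R] {Q : Type*} [Fintype Q] [DecidableEq Q]
  {O : Type*} {X : O → Type*} [∀ o, Fintype (X o)] [∀ o, DecidableEq (X o)]
  {s : O → O} (e : ∀ o, X (s o) ≃ Q × X o)

/-- `M` with a new coordinate on which it acts as the identity. -/
def padM (m n : O) (M : Matrix (X n) (X m) R) : Matrix (X (s n)) (X (s m)) R :=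
  fun j i => if (e n j).1 = (e m i).1 then M (e n j).2 (e m i).2 else 0

variable (R) in
/-- The matrix which compares and forgets the two leading coordinates. -/
def capM (o : O) : Matrix (X o) (X (s (s o))) R := fun j i =>
  if (e _ i).1 = (e _ (e _ i).2).1 ∧ (e _ (e _ i).2).2 = j then 1 else 0

variable (R) in
/-- The transpose of `capM`. -/
def cupM (o : O) : Matrix (X (s (s o))) (X o) R := fun j i =>
  if (e _ j).1 = (e _ (e _ j).2).1 ∧ (e _ (e _ j).2).2 = i then 1 else 0

variable (R) in
/-- The permutation matrix which exchanges the two leading coordinates. -/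
def swapM (o : O) : Matrix (X (s (s o))) (X (s (s o))) R := fun j i =>
  if (e _ j).1 = (e _ (e _ i).2).1 ∧ (e _ (e _ j).2).1 = (e _ i).1 ∧
    (e _ (e _ j).2).2 = (e _ (e _ i).2).2 then 1 else 0

theorem sumX (o : O) (f : X (s o) → R) :
    ∑ x, f x = ∑ a : Q, ∑ y : X o, f ((e o).symm (a, y)) := by
  rw [← (e o).symm.sum_comp, Fintype.sum_prod_type]

theorem padM_one (o : O) : padM e o o (1 : Matrix (X o) (X o) R) = 1 := by
  ext j i
  obtain ⟨⟨a, j⟩, rfl⟩ := (e o).symm.surjective j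
  obtain ⟨⟨b, i⟩, rfl⟩ := (e o).symm.surjective i
  simp [padM, Matrix.one_apply, ← ite_and]

theorem padM_mul (m n q : O) (N : Matrix (X q) (X n) R) (M : Matrix (X n) (X m) R) :
    padM e m q (N * M) = padM e n q N * padM e m n M := by
  ext j i
  simp [padM, Matrix.mul_apply, sumX e]

theorem capM_nat (m n : O) (M : Matrix (X n) (X m) R) :
    capM R e n * padM e (s m) (s n) (padM e m n M) = M * capM R e m := by
  ext j i
  simp [padM, capM, Matrix.mul_apply, sumX e, ite_and]

theorem cupM_nat (m n : O) (M : Matrix (X n) (X m) R) :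
    cupM R e n * M = padM e (s m) (s n) (padM e m n M) * cupM R e m := by
  ext j i
  simp [padM, cupM, Matrix.mul_apply, sumX e, ite_and]
  grind

theorem swapM_nat (m n : O) (M : Matrix (X n) (X m) R) :
    swapM R e n * padM e (s m) (s n) (padM e m n M) = padM e (s m) (s n) (padM e m n M) * swapM R e m := by
  ext j i
  simp [padM, swapM, Matrix.mul_apply, sumX e, ite_and]

theorem tri1 (o : O) :
    capM R e (s o) * padM e o (s (s o)) (cupM R e o) = (1 : Matrix (X (s o)) (X (s o)) R) := by
  ext j i
  obtain ⟨⟨a, j⟩, rfl⟩ := (e o).symm.surjective j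
  obtain ⟨⟨b, i⟩, rfl⟩ := (e o).symm.surjective i
  simp [padM, capM, cupM, Matrix.mul_apply, Matrix.one_apply, sumX e, ite_and]
  grind

theorem tri2 (o : O) :
    padM e (s (s o)) o (capM R e o) * cupM R e (s o) = (1 : Matrix (X (s o)) (X (s o)) R) := by
  ext j i
  obtain ⟨⟨a, j⟩, rfl⟩ := (e o).symm.surjective j
  obtain ⟨⟨b, i⟩, rfl⟩ := (e o).symm.surjective i
  simp [padM, capM, cupM, Matrix.mul_apply, Matrix.one_apply, sumX e, ite_and]
  grind

theorem swapM_swapM (o : O) :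
    swapM R e o * swapM R e o = (1 : Matrix (X (s (s o))) (X (s (s o))) R) := by
  ext j i
  obtain ⟨⟨a, j⟩, rfl⟩ := (e _).symm.surjective j
  obtain ⟨⟨a', j⟩, rfl⟩ := (e _).symm.surjective j
  obtain ⟨⟨b, i⟩, rfl⟩ := (e _).symm.surjective i
  obtain ⟨⟨b', i⟩, rfl⟩ := (e _).symm.surjective i
  simp [swapM, Matrix.mul_apply, Matrix.one_apply, sumX e, ite_and]

theorem capM_swapM (o : O) : capM R e o * swapM R e o = (capM R e o : Matrix (X o) (X (s (s o))) R) := by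
  ext j i
  obtain ⟨⟨b, i⟩, rfl⟩ := (e _).symm.surjective i
  obtain ⟨⟨b', i⟩, rfl⟩ := (e _).symm.surjective i
  simp [swapM, capM, Matrix.mul_apply, sumX e, ite_and]
  grind

theorem swapM_cupM (o : O) : swapM R e o * cupM R e o = (cupM R e o : Matrix (X (s (s o))) (X o) R) := by
  ext j i
  obtain ⟨⟨b, j⟩, rfl⟩ := (e _).symm.surjective j
  obtain ⟨⟨b', j⟩, rfl⟩ := (e _).symm.surjective j
  simp [swapM, cupM, Matrix.mul_apply, sumX e, ite_and]
  grind

theorem capM_slide (o : O) : capM R e (s o) * padM e (s (s o)) (s (s o)) (swapM R e o) =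
    (padM e (s (s o)) o (capM R e o) * swapM R e (s o) : Matrix (X (s o)) (X (s (s (s o)))) R) := by
  ext j i
  obtain ⟨⟨b, j⟩, rfl⟩ := (e _).symm.surjective j
  obtain ⟨⟨a, i⟩, rfl⟩ := (e _).symm.surjective i
  obtain ⟨⟨a', i⟩, rfl⟩ := (e _).symm.surjective i
  obtain ⟨⟨a'', i⟩, rfl⟩ := (e _).symm.surjective i
  simp [swapM, capM, padM, Matrix.mul_apply, sumX e, ite_and]
  grind

theorem cupM_slide (o : O) : swapM R e (s o) * padM e o (s (s o)) (cupM R e o) =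
    (padM e (s (s o)) (s (s o)) (swapM R e o) * cupM R e (s o) : Matrix (X (s (s (s o)))) (X (s o)) R) := by
  ext j i
  obtain ⟨⟨b, i⟩, rfl⟩ := (e _).symm.surjective i
  obtain ⟨⟨a, j⟩, rfl⟩ := (e _).symm.surjective j
  obtain ⟨⟨a', j⟩, rfl⟩ := (e _).symm.surjective j
  obtain ⟨⟨a'', j⟩, rfl⟩ := (e _).symm.surjective j
  simp [swapM, cupM, padM, Matrix.mul_apply, sumX e, ite_and]

theorem braid (o : O) : swapM R e (s o) * (padM e (s (s o)) (s (s o)) (swapM R e o) * swapM R e (s o)) =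
    (padM e (s (s o)) (s (s o)) (swapM R e o) * (swapM R e (s o) * padM e (s (s o)) (s (s o)) (swapM R e o)) :
      Matrix (X (s (s (s o)))) (X (s (s (s o)))) R) := by
  ext j i
  obtain ⟨⟨b, i⟩, rfl⟩ := (e _).symm.surjective i
  obtain ⟨⟨b', i⟩, rfl⟩ := (e _).symm.surjective i
  obtain ⟨⟨b'', i⟩, rfl⟩ := (e _).symm.surjective i
  obtain ⟨⟨a, j⟩, rfl⟩ := (e _).symm.surjective j
  obtain ⟨⟨a', j⟩, rfl⟩ := (e _).symm.surjective j
  obtain ⟨⟨a'', j⟩, rfl⟩ := (e _).symm.surjective j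
  simp [swapM, padM, Matrix.mul_apply, sumX e, ite_and]

end

/-! ### The category of matrices -/

/-- Objects of the category of matrices over `K`: natural numbers. -/
structure MatCat (K : Type u) : Type where
  dim : ℕ

section MatCat

variable (K : Type u) [Field K]

/-- An arrow `m ⟶ n` is an `n × m` matrix and composition is matrix multiplication:
`f ≫ g`, that is `g ∘ f`, is `g * f`. -/
instance : Category.{u} (MatCat K) where
  Hom m n := Matrix (Fin n.dim) (Fin m.dim) K
  id m := (1 : Matrix (Fin m.dim) (Fin m.dim) K)
  comp {m n q} (f : Matrix (Fin n.dim) (Fin m.dim) K) (g : Matrix (Fin q.dim) (Fin n.dim) K) :=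
    g * f
  id_comp f := Matrix.mul_one f
  comp_id f := Matrix.one_mul f
  assoc f g h := (Matrix.mul_assoc h g f).symm

/-- The identification of `Fin (p * n)` with pairs, in lexicographic order. -/
def splitFin (p n : ℕ) : Fin (p * n) ≃ Fin p × Fin n := finProdFinEquiv.symm

open Kronecker in
/-- The functor `p ⊗ _`: it maps `n` to `p * n` and `M` to the Kronecker product of `I_p` and `M`. -/
def tensorLeft (p : ℕ) : MatCat K ⥤ MatCat K where
  obj n := ⟨p * n.dim⟩
  map {m n} (M : Matrix (Fin n.dim) (Fin m.dim) K) :=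
    Matrix.reindex (splitFin p n.dim).symm (splitFin p m.dim).symm
      ((1 : Matrix (Fin p) (Fin p) K) ⊗ₖ M)
  map_id m := by
    change Matrix.reindex _ _ ((1 : Matrix (Fin p) (Fin p) K) ⊗ₖ
      (1 : Matrix (Fin m.dim) (Fin m.dim) K)) = (1 : Matrix (Fin (p * m.dim)) (Fin (p * m.dim)) K)
    simp
  map_comp {m n q} (f : Matrix (Fin n.dim) (Fin m.dim) K)
      (g : Matrix (Fin q.dim) (Fin n.dim) K) := by
    change Matrix.reindex _ _ ((1 : Matrix (Fin p) (Fin p) K) ⊗ₖ (g * f)) =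
      Matrix.reindex _ _ ((1 : Matrix (Fin p) (Fin p) K) ⊗ₖ g) *
        Matrix.reindex _ _ ((1 : Matrix (Fin p) (Fin p) K) ⊗ₖ f)
    rw [Matrix.reindex_apply, Matrix.reindex_apply, Matrix.reindex_apply,
      Matrix.submatrix_mul_equiv, ← Matrix.mul_kronecker_mul, one_mul]

theorem tensorLeft_map (p : ℕ) {m n : MatCat K} (M : m ⟶ n) :
    (tensorLeft K p).map M =
      padM (X := Fin) (s := fun n => p * n) (splitFin p) m.dim n.dim M := by
  funext j i
  change (1 : Matrix (Fin p) (Fin p) K) _ _ * M _ _ = _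
  simp [padM, Matrix.one_apply]

theorem tensorLeft_map_map (p : ℕ) {m n : MatCat K} (M : m ⟶ n) :
    (tensorLeft K p).map ((tensorLeft K p).map M) =
      padM (X := Fin) (s := fun n => p * n) (splitFin p) (p * m.dim) (p * n.dim)
        (padM (X := Fin) (s := fun n => p * n) (splitFin p) m.dim n.dim M) :=
  (tensorLeft_map K p _).trans (congrArg
    (fun N => padM (X := Fin) (s := fun n => p * n) (splitFin p) (p * m.dim) (p * n.dim) N)
    (tensorLeft_map K p M))

/-- The symmetric self-adjunction `⟨Mat, p ⊗ _, φ, γ, χ⟩`.  Under the lexicographic identification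
of `Fin (p * (p * n))` with triples `(a, b, i)`, the matrix `φ n` has in row `j` and column
`(a, b, i)` the entry `δ a b * δ i j`, `γ n` is its transpose, and `χ n` is the permutation matrix
which exchanges `a` and `b`. -/
def matSSA (p : ℕ) : SymSelfAdj (MatCat K) where
  F := tensorLeft K p
  adj :=
    { unit :=
        { app := fun n => cupM (X := Fin) (s := fun n => p * n) K (splitFin p) n.dim
          naturality := by
            intro m n f
            rw [Functor.comp_map, tensorLeft_map_map]
            exact cupM_nat (X := Fin) (s := fun n => p * n) (splitFin p) m.dim n.dim f }
      counit :=
        { app := fun n => capM (X := Fin) (s := fun n => p * n) K (splitFin p) n.dim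
          naturality := by
            intro m n f
            rw [Functor.comp_map, tensorLeft_map_map]
            exact capM_nat (X := Fin) (s := fun n => p * n) (splitFin p) m.dim n.dim f }
      left_triangle_components := fun n => by
        rw [tensorLeft_map]
        exact tri1 (X := Fin) (s := fun n => p * n) (splitFin p) n.dim
      right_triangle_components := fun n => by
        rw [tensorLeft_map]
        exact tri2 (X := Fin) (s := fun n => p * n) (splitFin p) n.dim }
  χ :=
    { app := fun n => swapM (X := Fin) (s := fun n => p * n) K (splitFin p) n.dim
      naturality := by
        intro m n f
        rw [Functor.comp_map, tensorLeft_map_map]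
        exact swapM_nat (X := Fin) (s := fun n => p * n) (splitFin p) m.dim n.dim f }
  χ_χ n := swapM_swapM (X := Fin) (s := fun n => p * n) (splitFin p) n.dim
  braid n := by
    rw [tensorLeft_map]
    refine (Matrix.mul_assoc _ _ _).trans ?_
    refine (braid (X := Fin) (s := fun n => p * n) (splitFin p) n.dim).trans ?_
    exact (Matrix.mul_assoc _ _ _).symm
  χ_φ n := capM_swapM (X := Fin) (s := fun n => p * n) (splitFin p) n.dim
  γ_χ n := swapM_cupM (X := Fin) (s := fun n => p * n) (splitFin p) n.dim
  χ_φ_slide n := by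
    rw [tensorLeft_map, tensorLeft_map]
    exact capM_slide (X := Fin) (s := fun n => p * n) (splitFin p) n.dim
  γ_χ_slide n := by
    rw [tensorLeft_map, tensorLeft_map]
    exact cupM_slide (X := Fin) (s := fun n => p * n) (splitFin p) n.dim

end MatCat


/-! ### Brauer's diagrams -/

/-- An `m`-`n`-diagram: `m` vertices in the top row, `n` vertices in the bottom row, and each of
the `m + n` vertices `x` is joined by a thread to exactly one other vertex, `link x`. -/
structure Diagram (m n : ℕ) where
  link : Fin m ⊕ Fin n → Fin m ⊕ Fin n
  link_link : ∀ x, link (link x) = x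
  link_ne : ∀ x, link x ≠ x

namespace Diagram

@[ext] theorem ext {m n : ℕ} {D E : Diagram m n} (h : ∀ x, D.link x = E.link x) : D = E := by
  cases D; cases E; congr; exact funext h

variable {m n q : ℕ}

/-- Gluing an `m`-`n`-diagram on top of an `n`-`q`-diagram gives three rows of vertices; this is
the position of the vertices of the upper diagram. -/
def upper (m n q : ℕ) : Fin m ⊕ Fin n → Fin m ⊕ Fin n ⊕ Fin q := Sum.map id Sum.inl

/-- The position of the vertices of the lower diagram. -/
def lower (m n q : ℕ) : Fin n ⊕ Fin q → Fin m ⊕ Fin n ⊕ Fin q := Sum.inr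

/-- The vertices of the top and the bottom of the three rows. -/
def outer (m n q : ℕ) : Fin m ⊕ Fin q → Fin m ⊕ Fin n ⊕ Fin q := Sum.map id Sum.inr

theorem upper_injective : Function.Injective (upper m n q) :=
  Function.injective_id.sumMap Sum.inl_injective

theorem outer_injective : Function.Injective (outer m n q) :=
  Function.injective_id.sumMap Sum.inr_injective

/-- The graph obtained by identifying the bottom row of `D₁` with the top row of `D₂`. -/
def glue (D₁ : Diagram m n) (D₂ : Diagram n q) : SimpleGraph (Fin m ⊕ Fin n ⊕ Fin q) where
  Adj x y := (∃ z, x = upper m n q z ∧ y = upper m n q (D₁.link z)) ∨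
    (∃ z, x = lower m n q z ∧ y = lower m n q (D₂.link z))
  symm := ⟨by
    rintro x y (⟨z, rfl, rfl⟩ | ⟨z, rfl, rfl⟩)
    · exact Or.inl ⟨D₁.link z, rfl, by rw [D₁.link_link]⟩
    · exact Or.inr ⟨D₂.link z, rfl, by rw [D₂.link_link]⟩⟩
  loopless := ⟨by
    rintro x (⟨z, rfl, h⟩ | ⟨z, rfl, h⟩)
    · exact D₁.link_ne z (upper_injective h).symm
    · exact D₂.link_ne z (Sum.inr_injective h).symm⟩

theorem refl_zpow {V : Type*} (a b : Equiv.Perm V) (ha : ∀ x, a (a x) = x)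
    (hb : ∀ x, b (b x) = x) (x : V) (hx : a x = x) (k : ℤ) :
    a (((a * b) ^ k) x) = ((a * b) ^ (-k)) x := by
  have ha' : a * a = 1 := Equiv.ext ha
  have hb' : b * b = 1 := Equiv.ext hb
  have h : SemiconjBy a (a * b) (a * b)⁻¹ := by
    rw [SemiconjBy, ← mul_assoc, ha', one_mul, mul_inv_rev, inv_mul_cancel_right,
      eq_inv_iff_mul_eq_one, hb']
  have h2 := congrArg (fun f : Equiv.Perm V => f x) (h.zpow_right k).eq
  simp only [Equiv.Perm.mul_apply, hx, inv_zpow'] at h2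
  exact h2

theorem dihedral {V : Type*} [Finite V] (a b : Equiv.Perm V) (ha : ∀ x, a (a x) = x)
    (hb : ∀ x, b (b x) = x) (hne : ∀ x, a x = x → b x ≠ x) (x : V) (hx : a x = x) :
    ∃ k : ℤ, ((a * b) ^ k) x ≠ x ∧
      (a (((a * b) ^ k) x) = ((a * b) ^ k) x ∨ b (((a * b) ^ k) x) = ((a * b) ^ k) x) ∧
      ∀ l : ℤ, (a (((a * b) ^ l) x) = ((a * b) ^ l) x ∨ b (((a * b) ^ l) x) = ((a * b) ^ l) x) →
        ((a * b) ^ l) x = x ∨ ((a * b) ^ l) x = ((a * b) ^ k) x := by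
  set c := a * b with hc
  have hac : ∀ k : ℤ, a ((c ^ k) x) = (c ^ (-k)) x := refl_zpow a b ha hb x hx
  have hbc : ∀ k : ℤ, b ((c ^ k) x) = (c ^ (-k - 1)) x := by
    intro k
    have h1 : b ((c ^ k) x) = a ((c ^ (k + 1)) x) := by
      rw [add_comm, zpow_add, zpow_one, Equiv.Perm.mul_apply, hc, Equiv.Perm.mul_apply, ha]
    rw [h1, hac]; congr 2; ring
  obtain ⟨N, hN0, hN⟩ : ∃ N : ℤ, 0 < N ∧ ∀ j : ℤ, (c ^ j) x = x ↔ N ∣ j := by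
    refine ⟨MulAction.period c x, ?_, fun j => ?_⟩
    · exact_mod_cast MulAction.period_pos_of_orderOf_pos (orderOf_pos c) x
    · exact MulAction.zpow_smul_eq_iff_period_dvd (g := c) (a := x)
  have heq : ∀ k l : ℤ, (c ^ k) x = (c ^ l) x ↔ N ∣ k - l := by
    intro k l
    rw [← hN, sub_eq_neg_add, zpow_add, Equiv.Perm.mul_apply, zpow_neg, Equiv.Perm.inv_eq_iff_eq]
  have hbx : ¬ N = 1 := by
    rintro rfl
    refine hne x hx ?_
    have := hbc 0
    simp only [zpow_zero, Equiv.Perm.one_apply] at this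
    rw [this, hN]; exact one_dvd _
  simp only [hac, hbc, heq, hN, ne_eq]
  refine ⟨N / 2, ?_, ?_, ?_⟩
  · intro h
    have := Int.le_of_dvd (by omega) h
    omega
  · rcases Int.even_or_odd' N with ⟨t, ht | ht⟩
    · left; exact ⟨-1, by omega⟩
    · right; exact ⟨-1, by omega⟩
  · rintro l (⟨t, ht⟩ | ⟨t, ht⟩)
    · rcases Int.even_or_odd' t with ⟨s, hs | hs⟩
      · left; refine ⟨-s, ?_⟩; subst hs
        linarith
      · right
        obtain ⟨r, hr⟩ : ∃ r, N = 2 * r := by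
          rcases Int.even_or_odd' N with ⟨r, hr | hr⟩
          · exact ⟨r, hr⟩
          · exfalso
            have : -l - l = 2 * (N * s + r) + 1 := by rw [ht, hs]; linear_combination hr
            omega
        refine ⟨-s - 1, ?_⟩
        have : N / 2 = r := by omega
        rw [this]; subst hr hs
        linarith
    · right
      obtain ⟨r, hr⟩ : ∃ r, N = 2 * r + 1 := by
        rcases Int.even_or_odd' N with ⟨r, hr | hr⟩
        · exfalso
          have : -l - 1 - l = 2 * (r * t) := by rw [ht, hr]; ring
          omega
        · exact ⟨r, hr⟩
      obtain ⟨s, hs⟩ : ∃ s, t = 2 * s + 1 := by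
        rcases Int.even_or_odd' t with ⟨s, hs | hs⟩
        · exfalso
          have : -l - 1 - l = 2 * (N * s) := by rw [ht, hs]; ring
          omega
        · exact ⟨s, hs⟩
      refine ⟨-s - 1, ?_⟩
      have : N / 2 = r := by omega
      rw [this]; subst hr hs
      linarith

/-- The upper diagram as a permutation of the three rows. -/
def permA (D₁ : Diagram m n) (q : ℕ) : Equiv.Perm (Fin m ⊕ Fin n ⊕ Fin q) :=
  Function.Involutive.toPerm
    (Sum.elim (fun i => upper m n q (D₁.link (Sum.inl i)))
      (Sum.elim (fun j => upper m n q (D₁.link (Sum.inr j))) (fun k => Sum.inr (Sum.inr k)))) (by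
    have key : ∀ z : Fin m ⊕ Fin n, (Sum.elim (fun i => upper m n q (D₁.link (Sum.inl i)))
      (Sum.elim (fun j => upper m n q (D₁.link (Sum.inr j))) (fun k => Sum.inr (Sum.inr k))))
        (upper m n q z) = upper m n q (D₁.link z) := by rintro (z | z) <;> rfl
    rintro (x | x | x)
    · simp only [Sum.elim_inl]; rw [key, D₁.link_link]; rfl
    · simp only [Sum.elim_inl, Sum.elim_inr]; rw [key, D₁.link_link]; rfl
    · rfl)

/-- The lower diagram as a permutation of the three rows. -/
def permB (D₂ : Diagram n q) (m : ℕ) : Equiv.Perm (Fin m ⊕ Fin n ⊕ Fin q) :=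
  Function.Involutive.toPerm (Sum.map id D₂.link) (by
    rintro (x | x)
    · rfl
    · simp [D₂.link_link])

theorem permA_upper (D₁ : Diagram m n) (z : Fin m ⊕ Fin n) :
    permA D₁ q (upper m n q z) = upper m n q (D₁.link z) := by rcases z with z | z <;> rfl

theorem permB_lower (D₂ : Diagram n q) (z : Fin n ⊕ Fin q) :
    permB D₂ m (lower m n q z) = lower m n q (D₂.link z) := rfl

theorem permA_permA (D₁ : Diagram m n) (x) : permA D₁ q (permA D₁ q x) = x :=
  Function.Involutive.toPerm_involutive _ x

theorem permB_permB (D₂ : Diagram n q) (x) : permB D₂ m (permB D₂ m x) = x :=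
  Function.Involutive.toPerm_involutive _ x

theorem permA_fix (D₁ : Diagram m n) (x) (h : permA D₁ q x = x) : ∃ k, x = Sum.inr (Sum.inr k) := by
  rcases x with x | x | x
  · exact absurd (upper_injective ((permA_upper D₁ (Sum.inl x)).symm.trans h)) (D₁.link_ne _)
  · exact absurd (upper_injective ((permA_upper D₁ (Sum.inr x)).symm.trans h)) (D₁.link_ne _)
  · exact ⟨x, rfl⟩

theorem permB_fix (D₂ : Diagram n q) (x) (h : permB D₂ m x = x) : ∃ k, x = Sum.inl k := by
  rcases x with x | x
  · exact ⟨x, rfl⟩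
  · exact absurd (Sum.inr_injective h) (D₂.link_ne _)

theorem permA_reachable (D₁ : Diagram m n) (D₂ : Diagram n q) (x) :
    (glue D₁ D₂).Reachable x (permA D₁ q x) := by
  rcases x with x | x | x
  · exact SimpleGraph.Adj.reachable (Or.inl ⟨Sum.inl x, rfl, rfl⟩)
  · exact SimpleGraph.Adj.reachable (Or.inl ⟨Sum.inr x, rfl, rfl⟩)
  · exact SimpleGraph.Reachable.refl _

theorem permB_reachable (D₁ : Diagram m n) (D₂ : Diagram n q) (x) :
    (glue D₁ D₂).Reachable x (permB D₂ m x) := by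
  rcases x with x | x
  · exact SimpleGraph.Reachable.refl _
  · exact SimpleGraph.Adj.reachable (Or.inr ⟨x, rfl, rfl⟩)

theorem glue_adj (D₁ : Diagram m n) (D₂ : Diagram n q) {x y} (h : (glue D₁ D₂).Adj x y) :
    y = permA D₁ q x ∨ y = permB D₂ m x := by
  rcases h with ⟨z, rfl, rfl⟩ | ⟨z, rfl, rfl⟩
  · exact Or.inl (permA_upper D₁ z).symm
  · exact Or.inr rfl

/-- An abstract form: an end point of a path has exactly one partner. -/
theorem partner_aux {V : Type*} [Finite V] (G : SimpleGraph V) (a b : Equiv.Perm V)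
    (ha : ∀ x, a (a x) = x) (hb : ∀ x, b (b x) = x) (hne : ∀ x, a x = x → b x ≠ x)
    (hGa : ∀ x, G.Reachable x (a x)) (hGb : ∀ x, G.Reachable x (b x))
    (hG : ∀ x y, G.Adj x y → y = a x ∨ y = b x) (x : V) (hx : a x = x) :
    ∃ y, (y ≠ x ∧ G.Reachable x y ∧ (a y = y ∨ b y = y)) ∧
      ∀ z, z ≠ x ∧ G.Reachable x z ∧ (a z = z ∨ b z = z) → z = y := by
  obtain ⟨k, hk1, hk2, hk3⟩ := dihedral a b ha hb hne x hx
  have hinv : (a * b)⁻¹ = b * a := by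
    ext y
    rw [Equiv.Perm.inv_eq_iff_eq]
    simp [ha, hb]
  have hr : ∀ k : ℤ, G.Reachable x (((a * b) ^ k) x) := by
    intro k
    induction k with
    | zero => exact SimpleGraph.Reachable.refl _
    | succ i ih =>
      rw [add_comm, zpow_add, zpow_one, Equiv.Perm.mul_apply, Equiv.Perm.mul_apply]
      exact ih.trans ((hGb _).trans (hGa _))
    | pred i ih =>
      rw [sub_eq_neg_add, zpow_add, zpow_neg_one, Equiv.Perm.mul_apply, hinv, Equiv.Perm.mul_apply]
      exact ih.trans ((hGa _).trans (hGb _))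
  have hs : ∀ z, G.Reachable x z → ∃ k : ℤ, z = ((a * b) ^ k) x := by
    intro z hz
    rw [SimpleGraph.reachable_iff_reflTransGen] at hz
    have hac : ∀ k : ℤ, a (((a * b) ^ k) x) = ((a * b) ^ (-k)) x := refl_zpow a b ha hb x hx
    induction hz with
    | refl => exact ⟨0, rfl⟩
    | tail _ hadj ih =>
      obtain ⟨k, rfl⟩ := ih
      rcases hG _ _ hadj with rfl | rfl
      · exact ⟨-k, hac k⟩
      · refine ⟨-(k + 1), ?_⟩
        rw [← hac, add_comm, zpow_add, zpow_one, Equiv.Perm.mul_apply, Equiv.Perm.mul_apply, ha]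
  refine ⟨_, ⟨hk1, hr k, hk2⟩, ?_⟩
  rintro z ⟨hz1, hz2, hz3⟩
  obtain ⟨l, rfl⟩ := hs z hz2
  exact (hk3 l hz3).resolve_left hz1

theorem partner (D₁ : Diagram m n) (D₂ : Diagram n q) (x : Fin m ⊕ Fin q) :
    ∃! y, y ≠ x ∧ (glue D₁ D₂).Reachable (outer m n q x) (outer m n q y) := by
  have hne : ∀ x, permA D₁ q x = x → permB D₂ m x ≠ x := by
    intro x h1 h2
    obtain ⟨k, rfl⟩ := permA_fix D₁ x h1
    obtain ⟨l, hl⟩ := permB_fix D₂ _ h2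
    cases hl
  have hout : ∀ z, (permA D₁ q z = z ∨ permB D₂ m z = z) ↔ ∃ y, z = outer m n q y := by
    intro z
    constructor
    · rintro (h | h)
      · obtain ⟨k, rfl⟩ := permA_fix D₁ z h
        exact ⟨Sum.inr k, rfl⟩
      · obtain ⟨k, rfl⟩ := permB_fix D₂ z h
        exact ⟨Sum.inl k, rfl⟩
    · rintro ⟨y | y, rfl⟩
      · exact Or.inr rfl
      · exact Or.inl rfl
  obtain ⟨y, ⟨hy1, hy2, hy3⟩, hy4⟩ : ∃ y, (y ≠ outer m n q x ∧
      (glue D₁ D₂).Reachable (outer m n q x) y ∧ (permA D₁ q y = y ∨ permB D₂ m y = y)) ∧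
      ∀ z, z ≠ outer m n q x ∧ (glue D₁ D₂).Reachable (outer m n q x) z ∧
        (permA D₁ q z = z ∨ permB D₂ m z = z) → z = y := by
    rcases (hout _).2 ⟨x, rfl⟩ with h | h
    · exact partner_aux (glue D₁ D₂) _ _ (permA_permA D₁) (permB_permB D₂) hne
        (permA_reachable D₁ D₂) (permB_reachable D₁ D₂) (fun _ _ h => glue_adj D₁ D₂ h) _ h
    · have := partner_aux (glue D₁ D₂) _ _ (permB_permB D₂) (permA_permA D₁)
        (fun x h1 h2 => hne x h2 h1) (permB_reachable D₁ D₂)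
        (permA_reachable D₁ D₂) (fun _ _ h => (glue_adj D₁ D₂ h).symm) _ h
      simpa only [or_comm] using this
  obtain ⟨w, rfl⟩ := (hout y).1 hy3
  refine ⟨w, ⟨fun h => hy1 (by rw [h]), hy2⟩, ?_⟩
  rintro z ⟨hz1, hz2⟩
  exact outer_injective (hy4 _ ⟨fun h => hz1 (outer_injective h), hz2, (hout _).2 ⟨z, rfl⟩⟩)

/-- The diagram part of the composite `D₂ ∘ D₁`: the partner of an outer vertex `x` is the unique
other outer vertex to which `x` is connected by concatenating threads of `D₁` and `D₂`. -/
noncomputable def comp (D₁ : Diagram m n) (D₂ : Diagram n q) : Diagram m q where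
  link x := (partner D₁ D₂ x).choose
  link_link x := by
    have h1 := (partner D₁ D₂ x).choose_spec.1
    exact (((partner D₁ D₂ (partner D₁ D₂ x).choose).choose_spec.2 x) ⟨h1.1.symm, h1.2.symm⟩).symm
  link_ne x := (partner D₁ D₂ x).choose_spec.1.1

theorem comp_reachable (D₁ : Diagram m n) (D₂ : Diagram n q) (x : Fin m ⊕ Fin q) :
    (glue D₁ D₂).Reachable (outer m n q x) (outer m n q ((comp D₁ D₂).link x)) :=
  (partner D₁ D₂ x).choose_spec.1.2

theorem comp_link_eq (D₁ : Diagram m n) (D₂ : Diagram n q) (x y : Fin m ⊕ Fin q) (h : y ≠ x)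
    (h2 : (glue D₁ D₂).Reachable (outer m n q x) (outer m n q y)) :
    y = (comp D₁ D₂).link x :=
  (partner D₁ D₂ x).choose_spec.2 y ⟨h, h2⟩

/-- The number of circular components that arise in the composition `D₂ ∘ D₁`, i.e. of the
connected components of the glued graph that contain no outer vertex. -/
noncomputable def circles (D₁ : Diagram m n) (D₂ : Diagram n q) : ℕ :=
  Nat.card {c : (glue D₁ D₂).ConnectedComponent //
    ∀ x : Fin m ⊕ Fin q, (glue D₁ D₂).connectedComponentMk (outer m n q x) ≠ c}

/-- The labelling of the vertices by `i` (top row) and `j` (bottom row) accepts `D`: linked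
vertices have equal labels. -/
def Accepts (D : Diagram m n) {C : Type*} (i : Fin m → C) (j : Fin n → C) : Prop :=
  ∀ x, Sum.elim i j (D.link x) = Sum.elim i j x

instance {C : Type*} [DecidableEq C] (D : Diagram m n) (i : Fin m → C) (j : Fin n → C) :
    Decidable (D.Accepts i j) := by unfold Accepts; infer_instance

/-- The 0/1-matrix of all accepted labellings by `t` labels. -/
def colM (t : ℕ) (D : Diagram m n) : Matrix (Fin n → Fin t) (Fin m → Fin t) ℕ :=
  fun j i => if D.Accepts i j then 1 else 0

theorem accepts_glue (D₁ : Diagram m n) (D₂ : Diagram n q) {C : Type*} (i : Fin m → C)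
    (c : Fin n → C) (j : Fin q → C) : (D₁.Accepts i c ∧ D₂.Accepts c j) ↔
      ∀ x y, (glue D₁ D₂).Reachable x y →
        Sum.elim i (Sum.elim c j) x = Sum.elim i (Sum.elim c j) y := by
  have hu : ∀ z, Sum.elim i (Sum.elim c j) (upper m n q z) = Sum.elim i c z := by
    rintro (z | z) <;> rfl
  constructor
  · rintro ⟨h1, h2⟩ x y h
    rw [SimpleGraph.reachable_iff_reflTransGen] at h
    induction h with
    | refl => rfl
    | tail _ hadj ih =>
      rw [ih]
      rcases hadj with ⟨z, rfl, rfl⟩ | ⟨z, rfl, rfl⟩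
      · rw [hu, hu, h1]
      · exact (h2 z).symm
  · intro h
    refine ⟨fun z => ?_, fun z => ?_⟩
    · rw [← hu, ← hu]
      exact (h _ _ (SimpleGraph.Adj.reachable (Or.inl ⟨z, rfl, rfl⟩))).symm
    · exact (h _ _ (SimpleGraph.Adj.reachable
        (Or.inr ⟨z, rfl, rfl⟩ : (glue D₁ D₂).Adj (lower m n q z) _))).symm

open Classical in
theorem card_colourings (t : ℕ) (D₁ : Diagram m n) (D₂ : Diagram n q) (i : Fin m → Fin t)
    (j : Fin q → Fin t) :
    Nat.card {c : Fin n → Fin t // D₁.Accepts i c ∧ D₂.Accepts c j} =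
      if (comp D₁ D₂).Accepts i j then t ^ circles D₁ D₂ else 0 := by
  have ho : ∀ c z, Sum.elim i (Sum.elim c j) (outer m n q z) = Sum.elim i j z := by
    rintro c (z | z) <;> rfl
  split_ifs with h
  · set P := {c : (glue D₁ D₂).ConnectedComponent //
      ∀ x : Fin m ⊕ Fin q, (glue D₁ D₂).connectedComponentMk (outer m n q x) ≠ c}
    let f : {c : Fin n → Fin t // D₁.Accepts i c ∧ D₂.Accepts c j} → (P → Fin t) :=
      fun c K => Sum.elim i (Sum.elim c.1 j) (Quot.out K.1)
    have hval : ∀ c : {c : Fin n → Fin t // D₁.Accepts i c ∧ D₂.Accepts c j}, ∀ x y,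
        (glue D₁ D₂).Reachable x y →
        Sum.elim i (Sum.elim c.1 j) x = Sum.elim i (Sum.elim c.1 j) y :=
      fun c => (accepts_glue D₁ D₂ i c.1 j).1 c.2
    have hout : ∀ K : (glue D₁ D₂).ConnectedComponent,
        (glue D₁ D₂).connectedComponentMk (Quot.out K) = K := fun K => Quot.out_eq K
    have hf : Function.Bijective f := by
      constructor
      · intro c c' hcc
        ext v : 2
        let K := (glue D₁ D₂).connectedComponentMk (Sum.inr (Sum.inl v))
        by_cases hK : ∀ x : Fin m ⊕ Fin q, (glue D₁ D₂).connectedComponentMk (outer m n q x) ≠ K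
        · have h1 := congrFun hcc ⟨K, hK⟩
          have h2 : (glue D₁ D₂).Reachable (Quot.out K) (Sum.inr (Sum.inl v)) :=
            SimpleGraph.ConnectedComponent.exact (hout K)
          have h3 := hval c _ _ h2
          have h4 := hval c' _ _ h2
          exact h3.symm.trans (h1.trans h4)
        · push Not at hK
          obtain ⟨x, hx⟩ := hK
          have h2 := SimpleGraph.ConnectedComponent.exact hx
          have h3 := hval c _ _ h2
          have h4 := hval c' _ _ h2
          rw [ho] at h3 h4
          exact h3.symm.trans h4
      · intro s
        let T : (glue D₁ D₂).ConnectedComponent → Fin t := fun K =>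
          if hK : ∀ x : Fin m ⊕ Fin q, (glue D₁ D₂).connectedComponentMk (outer m n q x) ≠ K
          then s ⟨K, hK⟩ else Sum.elim i j (not_forall.1 hK).choose
        have hT : ∀ x, T ((glue D₁ D₂).connectedComponentMk (outer m n q x)) = Sum.elim i j x := by
          intro x
          have hK : ¬ ∀ y : Fin m ⊕ Fin q, (glue D₁ D₂).connectedComponentMk (outer m n q y) ≠
            (glue D₁ D₂).connectedComponentMk (outer m n q x) := fun h => h x rfl
          simp only [T, dif_neg hK]
          have h1 := (not_forall.1 hK).choose_spec
          set y := (not_forall.1 hK).choose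
          have h2 := SimpleGraph.ConnectedComponent.exact (not_not.1 h1)
          by_cases hyx : y = x
          · rw [hyx]
          · rw [comp_link_eq D₁ D₂ x y hyx h2.symm]
            exact h x
        let c : Fin n → Fin t := fun v =>
          T ((glue D₁ D₂).connectedComponentMk (Sum.inr (Sum.inl v)))
        have hc : ∀ x, Sum.elim i (Sum.elim c j) x = T ((glue D₁ D₂).connectedComponentMk x) := by
          rintro (x | x | x)
          · exact (hT (Sum.inl x)).symm
          · rfl
          · exact (hT (Sum.inr x)).symm
        refine ⟨⟨c, (accepts_glue D₁ D₂ i c j).2 fun x y hxy => ?_⟩, ?_⟩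
        · rw [hc, hc, SimpleGraph.ConnectedComponent.sound hxy]
        · funext K
          simp only [f, hc, hout, T]
          exact dif_pos K.2
    rw [Nat.card_eq_of_bijective f hf, Nat.card_fun, Nat.card_fin]
    rfl
  · rw [Nat.card_eq_zero]
    left
    refine ⟨fun c => h fun x => ?_⟩
    rw [← ho c.1, ← ho c.1]
    exact ((accepts_glue D₁ D₂ i c.1 j).1 c.2 _ _ (comp_reachable D₁ D₂ x)).symm

theorem colM_mul (t : ℕ) (D₁ : Diagram m n) (D₂ : Diagram n q) :
    colM t D₂ * colM t D₁ = t ^ circles D₁ D₂ • colM t (comp D₁ D₂) := by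
  ext j i
  have := card_colourings t D₁ D₂ i j
  rw [Nat.card_eq_fintype_card, Fintype.card_subtype, Finset.card_filter] at this
  simp only [Matrix.mul_apply, Matrix.smul_apply, colM, ← ite_and, mul_ite, mul_one, mul_zero,
    smul_eq_mul]
  rw [← this]

theorem colM_injective {k l : ℕ} {D E : Diagram m n}
    (h : 2 ^ k • colM 2 D = 2 ^ l • colM 2 E) : k = l ∧ D = E := by
  have hent : ∀ i j, (2 ^ k * if D.Accepts i j then 1 else 0) =
      (2 ^ l * if E.Accepts i j then 1 else 0) := fun i j => congrFun (congrFun h j) i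
  have h0 : ∀ D : Diagram m n, D.Accepts (fun _ => (0 : Fin 2)) (fun _ => 0) := by
    intro D x
    rcases x with x | x <;> rcases D.link _ with y | y <;> rfl
  have hkl : k = l := by
    have := hent (fun _ => 0) (fun _ => 0)
    rw [if_pos (h0 D), if_pos (h0 E), mul_one, mul_one] at this
    exact Nat.pow_right_injective le_rfl this
  refine ⟨hkl, ?_⟩
  subst hkl
  have hacc : ∀ (i : Fin m → Fin 2) (j : Fin n → Fin 2), D.Accepts i j ↔ E.Accepts i j := by
    intro i j
    have := Nat.eq_of_mul_eq_mul_left (by positivity) (hent i j)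
    split_ifs at this <;> simp_all
  ext x : 1
  let g : Fin m ⊕ Fin n → Fin 2 := fun y => if y = x ∨ y = D.link x then 1 else 0
  have hg : Sum.elim (fun a => g (Sum.inl a)) (fun a => g (Sum.inr a)) = g := by
    ext (y | y) <;> rfl
  have hD : D.Accepts (fun a => g (Sum.inl a)) (fun a => g (Sum.inr a)) := by
    intro y
    rw [hg]
    have : (D.link y = x ∨ D.link y = D.link x) ↔ (y = x ∨ y = D.link x) := by
      constructor
      · rintro (h | h)
        · right; rw [← h, D.link_link]
        · left; rw [← D.link_link y, h, D.link_link]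
      · rintro (h | h)
        · right; rw [h]
        · left; rw [h, D.link_link]
    simp only [g, this]
  have hE := (hacc _ _).1 hD x
  rw [hg] at hE
  have : E.link x = x ∨ E.link x = D.link x := by
    by_contra hcon
    simp [g, hcon] at hE
  exact (this.resolve_left (E.link_ne x)).symm

/-- The diagram `I_n`. -/
def one (n : ℕ) : Diagram n n where
  link := Sum.swap
  link_link x := by simp
  link_ne := by rintro (x | x) <;> simp

/-- The diagram `D` with a new vertical thread added on the left. -/
def pad (D : Diagram m n) : Diagram (m + 1) (n + 1) where
  link := Sum.elim
    (Fin.cases (Sum.inr 0) fun i => Sum.map Fin.succ Fin.succ (D.link (Sum.inl i)))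
    (Fin.cases (Sum.inl 0) fun j => Sum.map Fin.succ Fin.succ (D.link (Sum.inr j)))
  link_link := by
    have key : ∀ z : Fin m ⊕ Fin n, (Sum.elim
      (Fin.cases (Sum.inr 0) fun i => Sum.map Fin.succ Fin.succ (D.link (Sum.inl i)))
      (Fin.cases (Sum.inl 0) fun j => Sum.map Fin.succ Fin.succ (D.link (Sum.inr j))) :
        Fin (m + 1) ⊕ Fin (n + 1) → Fin (m + 1) ⊕ Fin (n + 1)) (Sum.map Fin.succ Fin.succ z) =
        Sum.map Fin.succ Fin.succ (D.link z) := by rintro (z | z) <;> rfl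
    rintro (x | x) <;> cases x using Fin.cases
    · rfl
    · exact (key _).trans (by rw [D.link_link]; rfl)
    · rfl
    · exact (key _).trans (by rw [D.link_link]; rfl)
  link_ne := by
    have hinj : Function.Injective (Sum.map Fin.succ Fin.succ :
        Fin m ⊕ Fin n → Fin (m + 1) ⊕ Fin (n + 1)) :=
      (Fin.succ_injective m).sumMap (Fin.succ_injective n)
    rintro (x | x) <;> cases x using Fin.cases
    · exact Sum.inr_ne_inl
    · exact fun h => D.link_ne _ (hinj h)
    · exact Sum.inl_ne_inr
    · exact fun h => D.link_ne _ (hinj h)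

/-- The first two vertices of the top row are linked; the others go straight down. -/
def cap (n : ℕ) : Diagram (n + 2) n where
  link := Sum.elim
    (Fin.cases (Sum.inl 1) (Fin.cases (Sum.inl 0) Sum.inr))
    (fun j => Sum.inl j.succ.succ)
  link_link := by
    rintro (x | x)
    · cases x using Fin.cases with
      | zero => rfl
      | succ x => cases x using Fin.cases <;> rfl
    · rfl
  link_ne := by
    rintro (x | x)
    · cases x using Fin.cases with
      | zero => exact fun h => absurd (Sum.inl_injective h) (by simp)
      | succ x =>
        cases x using Fin.cases with
        | zero => exact fun h => absurd (Sum.inl_injective h) (by simp)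
        | succ x => exact Sum.inr_ne_inl
    · exact Sum.inl_ne_inr

/-- The first two vertices of the bottom row are linked; the others go straight up. -/
def cup (n : ℕ) : Diagram n (n + 2) where
  link x := ((cap n).link x.swap).swap
  link_link x := by simp [(cap n).link_link]
  link_ne x h := (cap n).link_ne x.swap (by simpa using congrArg Sum.swap h)

/-- The threads from the first two vertices of the two rows cross; the others are vertical. -/
def cross (n : ℕ) : Diagram (n + 2) (n + 2) where
  link x := (x.map (Equiv.swap 0 1) (Equiv.swap 0 1)).swap
  link_link := by rintro (x | x) <;> simp
  link_ne := by rintro (x | x) <;> simp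

/-- Splitting off the label of the first vertex. -/
def splitFun (t n : ℕ) : (Fin (n + 1) → Fin t) ≃ Fin t × (Fin n → Fin t) :=
  (Fin.consEquiv fun _ => Fin t).symm

theorem colM_one (t n : ℕ) : colM t (one n) = 1 := by
  ext j i
  simp only [colM, Matrix.one_apply]
  congr 1
  simp only [Accepts, Sum.forall, one, Sum.swap_inl, Sum.swap_inr, Sum.elim_inl, Sum.elim_inr,
    eq_iff_iff]
  exact ⟨fun h => funext h.1, fun h => by simp [h]⟩

theorem colM_pad (t : ℕ) (D : Diagram m n) : colM t D.pad =
    padM (X := fun n => Fin n → Fin t) (s := fun n => n + 1) (splitFun t) m n (colM t D) := by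
  ext j i
  have : D.pad.Accepts i j ↔ j 0 = i 0 ∧ D.Accepts (Fin.tail i) (Fin.tail j) := by
    have key : ∀ z : Fin m ⊕ Fin n, Sum.elim i j (Sum.map Fin.succ Fin.succ z) =
        Sum.elim (Fin.tail i) (Fin.tail j) z := by rintro (z | z) <;> rfl
    constructor
    · intro h
      refine ⟨h (Sum.inl 0), fun z => ?_⟩
      rw [← key, ← key]
      rcases z with z | z
      · exact h (Sum.inl z.succ)
      · exact h (Sum.inr z.succ)
    · rintro ⟨h0, h⟩ (x | x) <;> cases x using Fin.cases
      · exact h0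
      · exact (key _).trans (h _)
      · exact h0.symm
      · exact (key _).trans (h _)
  simp only [colM, padM, splitFun, this, ite_and]
  rfl

theorem colM_cap (t n : ℕ) : colM t (cap n) =
    capM (X := fun n => Fin n → Fin t) (s := fun n => n + 1) ℕ (splitFun t) n := by
  ext j i
  have : (cap n).Accepts i j ↔ i 0 = i 1 ∧ Fin.tail (Fin.tail i) = j := by
    constructor
    · intro h
      exact ⟨(h (Sum.inl 0)).symm, funext fun z => h (Sum.inr z)⟩
    · rintro ⟨h0, rfl⟩ (x | x)
      · cases x using Fin.cases with
        | zero => exact h0.symm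
        | succ x =>
          cases x using Fin.cases with
          | zero => exact h0
          | succ x => rfl
      · rfl
  simp only [colM, this]
  rfl

theorem colM_cup (t n : ℕ) : colM t (cup n) =
    cupM (X := fun n => Fin n → Fin t) (s := fun n => n + 1) ℕ (splitFun t) n := by
  ext j i
  have : (cup n).Accepts i j ↔ j 0 = j 1 ∧ Fin.tail (Fin.tail j) = i := by
    constructor
    · intro h
      exact ⟨(h (Sum.inr 0)).symm, funext fun z => h (Sum.inl z)⟩
    · rintro ⟨h0, rfl⟩ (x | x)
      · rfl
      · cases x using Fin.cases with
        | zero => exact h0.symm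
        | succ x =>
          cases x using Fin.cases with
          | zero => exact h0
          | succ x => rfl
  simp only [colM, this]
  rfl

theorem colM_cross (t n : ℕ) : colM t (cross n) =
    swapM (X := fun n => Fin n → Fin t) (s := fun n => n + 1) ℕ (splitFun t) n := by
  ext j i
  have h2 : ∀ x : Fin n, Equiv.swap (0 : Fin (n + 2)) 1 x.succ.succ = x.succ.succ := fun x =>
    Equiv.swap_apply_of_ne_of_ne (by simp [Fin.ext_iff]) (by simp [Fin.ext_iff])
  have : (cross n).Accepts i j ↔
      j 0 = i 1 ∧ j 1 = i 0 ∧ Fin.tail (Fin.tail j) = Fin.tail (Fin.tail i) := by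
    have : (cross n).Accepts i j ↔ (∀ x, j (Equiv.swap 0 1 x) = i x) := by
      constructor
      · intro h x
        exact h (Sum.inl x)
      · rintro h (x | x)
        · exact h x
        · change i (Equiv.swap 0 1 x) = j x
          rw [← h, Equiv.swap_apply_self]
    rw [this]
    constructor
    · intro h
      refine ⟨?_, ?_, funext fun x => ?_⟩
      · rw [← h, Equiv.swap_apply_right]
      · rw [← h, Equiv.swap_apply_left]
      · exact (congrArg j (h2 x)).symm.trans (h _)
    · rintro ⟨h0, h1, h⟩ x
      cases x using Fin.cases with
      | zero => rw [Equiv.swap_apply_left, h1]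
      | succ x =>
        cases x using Fin.cases with
        | zero => exact (congrArg j (Equiv.swap_apply_right _ _)).trans h0
        | succ x => exact (congrArg j (h2 x)).trans (congrFun h x)
  simp only [colM, this]
  rfl

end Diagram

/-! ### The category of Brauer's diagrams -/

/-- Objects of the category `Br_p`: natural numbers. -/
structure Br (p : ℕ) : Type where
  width : ℕ

namespace Br

/-- Arrows `m ⟶ n` of `Br_p`: `m`-`n`-diagrams with a coefficient of the form `p ^ k`. -/
structure Hom {p : ℕ} (m n : Br p) : Type where
  coeff : ℕ
  coeff_pow : ∃ k, coeff = p ^ k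
  diag : Diagram m.width n.width

@[ext] theorem Hom.ext {p : ℕ} {m n : Br p} {f g : Hom m n} (h : f.coeff = g.coeff)
    (h' : f.diag = g.diag) : f = g := by
  cases f; cases g; cases h; cases h'; rfl

/-- The diagram `D` with coefficient `p ^ k`. -/
def Hom.scaled {p : ℕ} (k : ℕ) {m n : ℕ} (D : Diagram m n) : Hom (⟨m⟩ : Br p) ⟨n⟩ :=
  ⟨p ^ k, ⟨k, rfl⟩, D⟩

/-- Composition `g ∘ f`: the diagrams are composed, and a circular component counts as `p`. -/
noncomputable def Hom.comp {p : ℕ} {m n q : Br p} (f : Hom m n) (g : Hom n q) : Hom m q where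
  coeff := p ^ Diagram.circles f.diag g.diag * (f.coeff * g.coeff)
  coeff_pow := by
    obtain ⟨k, hk⟩ := f.coeff_pow
    obtain ⟨l, hl⟩ := g.coeff_pow
    exact ⟨f.diag.circles g.diag + (k + l), by rw [hk, hl, pow_add, pow_add]⟩
  diag := f.diag.comp g.diag

/-- A thread is added on the left. -/
def Hom.pad {p : ℕ} {m n : Br p} (f : Hom m n) :
    Hom (⟨m.width + 1⟩ : Br p) ⟨n.width + 1⟩ where
  coeff := f.coeff
  coeff_pow := f.coeff_pow
  diag := f.diag.pad

theorem Hom.exists_scaled {p : ℕ} {m n : Br p} (f : Hom m n) :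
    ∃ k D, f = Hom.scaled (p := p) (m := m.width) (n := n.width) k D := by
  obtain ⟨c, ⟨k, rfl⟩, D⟩ := f
  exact ⟨k, D, rfl⟩

theorem scaled_comp {p : ℕ} {m n q : ℕ} (k l : ℕ) (D : Diagram m n) (E : Diagram n q) :
    (Hom.scaled (p := p) k D).comp (Hom.scaled l E) =
      Hom.scaled (Diagram.circles D E + (k + l)) (D.comp E) :=
  Hom.ext (by simp [Hom.scaled, Hom.comp, pow_add]) rfl

theorem scaled_pad {p : ℕ} {m n : ℕ} (k : ℕ) (D : Diagram m n) :
    (Hom.scaled (p := p) k D).pad = Hom.scaled k D.pad := rfl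

theorem scaled_eq {p : ℕ} {m n : ℕ} {k l : ℕ} {D E : Diagram m n}
    (h : 2 ^ k • D.colM 2 = 2 ^ l • E.colM 2) :
    Hom.scaled (p := p) k D = Hom.scaled l E := by
  obtain ⟨rfl, rfl⟩ := Diagram.colM_injective h
  rfl

theorem colM_scaled_comp {m n q : ℕ} (k l : ℕ) (D : Diagram m n) (E : Diagram n q) :
    2 ^ (Diagram.circles D E + (k + l)) • (D.comp E).colM 2 =
      (2 ^ l • E.colM 2) * (2 ^ k • D.colM 2) := by
  rw [Matrix.smul_mul, Matrix.mul_smul, Diagram.colM_mul, smul_smul, smul_smul]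
  congr 1
  ring

theorem colM_scaled_pad {m n : ℕ} (k : ℕ) (D : Diagram m n) :
    2 ^ k • D.pad.colM 2 = padM (X := fun n => Fin n → Fin 2) (s := fun n => n + 1)
      (Diagram.splitFun 2) m n (2 ^ k • D.colM 2) := by
  rw [Diagram.colM_pad]
  ext j i
  simp [padM]

noncomputable instance (p : ℕ) : Category.{0} (Br p) where
  Hom m n := Hom m n
  id m := Hom.scaled (p := p) (n := m.width) 0 (Diagram.one m.width)
  comp f g := f.comp g
  id_comp f := by
    obtain ⟨k, D, rfl⟩ := f.exists_scaled
    rw [scaled_comp]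
    apply scaled_eq
    rw [colM_scaled_comp, Diagram.colM_one, pow_zero, one_smul, Matrix.mul_one]
  comp_id f := by
    obtain ⟨k, D, rfl⟩ := f.exists_scaled
    rw [scaled_comp]
    apply scaled_eq
    rw [colM_scaled_comp, Diagram.colM_one, pow_zero, one_smul, Matrix.one_mul]
  assoc f g h := by
    obtain ⟨k, D, rfl⟩ := f.exists_scaled
    obtain ⟨l, E, rfl⟩ := g.exists_scaled
    obtain ⟨r, G, rfl⟩ := h.exists_scaled
    rw [scaled_comp, scaled_comp, scaled_comp, scaled_comp]
    apply scaled_eq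
    rw [colM_scaled_comp, colM_scaled_comp, colM_scaled_comp, colM_scaled_comp, Matrix.mul_assoc]

/-- The arrow `p ^ k · D` of `Br_p`. -/
def scaled (p : ℕ) (k : ℕ) {m n : ℕ} (D : Diagram m n) : (⟨m⟩ : Br p) ⟶ ⟨n⟩ := Hom.scaled k D

/-- The diagram `D` as an arrow of `Br_p`, with coefficient 1. -/
def ofDiagram (p : ℕ) {m n : ℕ} (D : Diagram m n) : (⟨m⟩ : Br p) ⟶ ⟨n⟩ := scaled p 0 D

/-- The endofunctor of `Br_p` which adds a thread on the left. -/
noncomputable def functor (p : ℕ) : Br p ⥤ Br p where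
  obj n := ⟨n.width + 1⟩
  map f := Hom.pad f
  map_id n := by
    change Hom.scaled 0 (Diagram.one n.width).pad = Hom.scaled 0 (Diagram.one (n.width + 1))
    apply scaled_eq
    rw [Diagram.colM_pad, Diagram.colM_one, Diagram.colM_one]
    rw [padM_one]
  map_comp f g := by
    obtain ⟨k, D, rfl⟩ := Hom.exists_scaled f
    obtain ⟨l, E, rfl⟩ := Hom.exists_scaled g
    change ((Hom.scaled k D).comp (Hom.scaled l E)).pad =
      (Hom.scaled k D).pad.comp (Hom.scaled l E).pad
    rw [scaled_comp, scaled_pad, scaled_pad, scaled_pad, scaled_comp]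
    apply scaled_eq
    rw [colM_scaled_pad, colM_scaled_comp, colM_scaled_comp, colM_scaled_pad, colM_scaled_pad,
      padM_mul]

/-- The symmetric self-adjunction of diagrams: `φ` is the cap, `γ` the cup and `χ` the crossing. -/
noncomputable def ssa (p : ℕ) : SymSelfAdj (Br p) where
  F := functor p
  adj :=
    { unit :=
        { app := fun n => ofDiagram p (Diagram.cup n.width)
          naturality := by
            intro m n f
            obtain ⟨k, D, rfl⟩ := Hom.exists_scaled f
            change (Hom.scaled k D).comp (Hom.scaled 0 (Diagram.cup n.width)) =
              (Hom.scaled 0 (Diagram.cup m.width)).comp (Hom.scaled k D).pad.pad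
            rw [scaled_pad, scaled_pad, scaled_comp, scaled_comp]
            apply scaled_eq
            simp only [colM_scaled_comp, colM_scaled_pad, pow_zero, one_smul, Diagram.colM_cup]
            exact cupM_nat _ _ _ _ }
      counit :=
        { app := fun n => ofDiagram p (Diagram.cap n.width)
          naturality := by
            intro m n f
            obtain ⟨k, D, rfl⟩ := Hom.exists_scaled f
            change (Hom.scaled k D).pad.pad.comp (Hom.scaled 0 (Diagram.cap n.width)) =
              (Hom.scaled 0 (Diagram.cap m.width)).comp (Hom.scaled k D)
            rw [scaled_pad, scaled_pad, scaled_comp, scaled_comp]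
            apply scaled_eq
            simp only [colM_scaled_comp, colM_scaled_pad, pow_zero, one_smul, Diagram.colM_cap]
            exact capM_nat _ _ _ _ }
      left_triangle_components := fun n => by
        change (Hom.scaled 0 (Diagram.cup n.width)).pad.comp
            (Hom.scaled 0 (Diagram.cap (n.width + 1))) =
          Hom.scaled (p := p) 0 (Diagram.one (n.width + 1))
        rw [scaled_pad, scaled_comp]
        apply scaled_eq
        rw [colM_scaled_comp, colM_scaled_pad, pow_zero, one_smul, one_smul, one_smul,
          Diagram.colM_cap, Diagram.colM_cup, Diagram.colM_one]
        exact tri1 _ _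
      right_triangle_components := fun n => by
        change (Hom.scaled 0 (Diagram.cup (n.width + 1))).comp
            (Hom.scaled 0 (Diagram.cap n.width)).pad =
          Hom.scaled (p := p) 0 (Diagram.one (n.width + 1))
        rw [scaled_pad, scaled_comp]
        apply scaled_eq
        rw [colM_scaled_comp, colM_scaled_pad, pow_zero, one_smul, one_smul, one_smul,
          Diagram.colM_cap, Diagram.colM_cup, Diagram.colM_one]
        exact tri2 _ _ }
  χ :=
    { app := fun n => ofDiagram p (Diagram.cross n.width)
      naturality := by
        intro m n f
        obtain ⟨k, D, rfl⟩ := Hom.exists_scaled f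
        change (Hom.scaled k D).pad.pad.comp (Hom.scaled 0 (Diagram.cross n.width)) =
          (Hom.scaled 0 (Diagram.cross m.width)).comp (Hom.scaled k D).pad.pad
        rw [scaled_pad, scaled_pad, scaled_comp, scaled_comp]
        apply scaled_eq
        simp only [colM_scaled_comp, colM_scaled_pad, pow_zero, one_smul, Diagram.colM_cross]
        exact swapM_nat _ _ _ _ }
  χ_χ n := by
    change (Hom.scaled 0 (Diagram.cross n.width)).comp (Hom.scaled 0 (Diagram.cross n.width)) =
      Hom.scaled (p := p) 0 (Diagram.one (n.width + 2))
    rw [scaled_comp]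
    apply scaled_eq
    rw [colM_scaled_comp, pow_zero, one_smul, one_smul, Diagram.colM_cross, Diagram.colM_one]
    exact swapM_swapM _ _
  braid n := by
    change (Hom.scaled (p := p) 0 (Diagram.cross (n.width + 1))).comp
        ((Hom.scaled 0 (Diagram.cross n.width)).pad.comp
          (Hom.scaled 0 (Diagram.cross (n.width + 1)))) =
      (Hom.scaled (p := p) 0 (Diagram.cross n.width)).pad.comp
        ((Hom.scaled 0 (Diagram.cross (n.width + 1))).comp
          (Hom.scaled 0 (Diagram.cross n.width)).pad)
    rw [scaled_pad, scaled_comp, scaled_comp, scaled_comp, scaled_comp]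
    apply scaled_eq
    rw [colM_scaled_comp, colM_scaled_comp, colM_scaled_comp, colM_scaled_comp, colM_scaled_pad,
      pow_zero, one_smul, one_smul, Diagram.colM_cross, Diagram.colM_cross]
    exact (Matrix.mul_assoc _ _ _).trans ((braid _ _).trans (Matrix.mul_assoc _ _ _).symm)
  χ_φ n := by
    change (Hom.scaled 0 (Diagram.cross n.width)).comp (Hom.scaled 0 (Diagram.cap n.width)) =
      Hom.scaled (p := p) 0 (Diagram.cap n.width)
    rw [scaled_comp]
    apply scaled_eq
    rw [colM_scaled_comp, pow_zero, one_smul, one_smul, Diagram.colM_cross, Diagram.colM_cap]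
    exact capM_swapM _ _
  γ_χ n := by
    change (Hom.scaled 0 (Diagram.cup n.width)).comp (Hom.scaled 0 (Diagram.cross n.width)) =
      Hom.scaled (p := p) 0 (Diagram.cup n.width)
    rw [scaled_comp]
    apply scaled_eq
    rw [colM_scaled_comp, pow_zero, one_smul, one_smul, Diagram.colM_cross, Diagram.colM_cup]
    exact swapM_cupM _ _
  χ_φ_slide n := by
    change (Hom.scaled (p := p) 0 (Diagram.cross n.width)).pad.comp
        (Hom.scaled 0 (Diagram.cap (n.width + 1))) =
      (Hom.scaled 0 (Diagram.cross (n.width + 1))).comp (Hom.scaled 0 (Diagram.cap n.width)).pad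
    rw [scaled_pad, scaled_pad, scaled_comp, scaled_comp]
    apply scaled_eq
    rw [colM_scaled_comp, colM_scaled_comp, colM_scaled_pad, colM_scaled_pad]
    simp only [pow_zero, one_smul, Diagram.colM_cross, Diagram.colM_cap]
    exact capM_slide _ _
  γ_χ_slide n := by
    change (Hom.scaled (p := p) 0 (Diagram.cup n.width)).pad.comp
        (Hom.scaled 0 (Diagram.cross (n.width + 1))) =
      (Hom.scaled 0 (Diagram.cup (n.width + 1))).comp (Hom.scaled 0 (Diagram.cross n.width)).pad
    rw [scaled_pad, scaled_pad, scaled_comp, scaled_comp]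
    apply scaled_eq
    rw [colM_scaled_comp, colM_scaled_comp, colM_scaled_pad, colM_scaled_pad]
    simp only [pow_zero, one_smul, Diagram.colM_cross, Diagram.colM_cup]
    exact cupM_slide _ _

end Br

/-! ### Brauer's algebra and Brauer's matrices -/

/-- Brauer's algebra `B_n` over `K` (with parameter `p`): the vector space whose basis consists of
the `n`-diagrams. -/
def BrauerAlgebra (K : Type u) [Field K] (_p n : ℕ) : Type u := Diagram n n →₀ K

namespace BrauerAlgebra

variable (K : Type u) [Field K] (p n : ℕ)

noncomputable instance : AddCommGroup (BrauerAlgebra K p n) :=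
  inferInstanceAs (AddCommGroup (Diagram n n →₀ K))

noncomputable instance : Module K (BrauerAlgebra K p n) :=
  inferInstanceAs (Module K (Diagram n n →₀ K))

/-- The basis of `B_n`. -/
noncomputable def basis : Module.Basis (Diagram n n) K (BrauerAlgebra K p n) :=
  ⟨LinearEquiv.refl K (Diagram n n →₀ K)⟩

/-- Multiplication of `B_n`: the bilinear map with `D₂ * D₁ = p ^ k · (D₂ ∘ D₁)`, where `k` is the
number of circular components. -/
noncomputable def mulMap : BrauerAlgebra K p n →ₗ[K] BrauerAlgebra K p n →ₗ[K] BrauerAlgebra K p n :=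
  (basis K p n).constr K fun D₂ => (basis K p n).constr K fun D₁ =>
    (p : K) ^ Diagram.circles D₁ D₂ • basis K p n (D₁.comp D₂)

theorem mulMap_basis (D₂ D₁ : Diagram n n) :
    mulMap K p n (basis K p n D₂) (basis K p n D₁) =
      (p : K) ^ Diagram.circles D₁ D₂ • basis K p n (D₁.comp D₂) := by
  simp [mulMap]

theorem comp_comp (D E G : Diagram n n) :
    Diagram.circles (D.comp E) G + Diagram.circles D E =
      Diagram.circles D (E.comp G) + Diagram.circles E G ∧
    (D.comp E).comp G = D.comp (E.comp G) := by
  apply Diagram.colM_injective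
  rw [pow_add, mul_comm, mul_smul, ← Diagram.colM_mul, ← Matrix.mul_smul, ← Diagram.colM_mul,
    pow_add, mul_comm, mul_smul, ← Diagram.colM_mul, ← Matrix.smul_mul, ← Diagram.colM_mul,
    Matrix.mul_assoc]

theorem one_comp (D : Diagram n n) :
    Diagram.circles (Diagram.one n) D = 0 ∧ (Diagram.one n).comp D = D := by
  apply Diagram.colM_injective
  rw [← Diagram.colM_mul, Diagram.colM_one, Matrix.mul_one, pow_zero, one_smul]

theorem comp_one (D : Diagram n n) :
    Diagram.circles D (Diagram.one n) = 0 ∧ D.comp (Diagram.one n) = D := by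
  apply Diagram.colM_injective
  rw [← Diagram.colM_mul, Diagram.colM_one, Matrix.one_mul, pow_zero, one_smul]

variable {K p n} in
theorem basis_induction {P : BrauerAlgebra K p n → Prop} (x : BrauerAlgebra K p n) (zero : P 0)
    (add : ∀ x y, P x → P y → P (x + y)) (smul : ∀ (c : K) x, P x → P (c • x))
    (single : ∀ D, P (basis K p n D)) : P x := by
  refine Submodule.span_induction (p := fun x _ => P x) ?_ zero (fun x y _ _ => add x y)
    (fun c x _ => smul c x) ((basis K p n).mem_span x)
  rintro _ ⟨D, rfl⟩
  exact single D

theorem mulMap_assoc (x y z : BrauerAlgebra K p n) :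
    mulMap K p n (mulMap K p n x y) z = mulMap K p n x (mulMap K p n y z) := by
  induction x using basis_induction with
  | zero => simp
  | add _ _ h h' => simp [h, h']
  | smul _ _ h => simp [h]
  | single G =>
  induction y using basis_induction with
  | zero => simp
  | add _ _ h h' => simp [h, h']
  | smul _ _ h => simp [h]
  | single E =>
  induction z using basis_induction with
  | zero => simp
  | add _ _ h h' => simp [h, h']
  | smul _ _ h => simp [h]
  | single D =>
  obtain ⟨h1, h2⟩ := comp_comp n D E G
  simp only [mulMap_basis, map_smul, LinearMap.smul_apply, smul_smul, ← pow_add, h2]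
  congr 2
  omega

theorem mulMap_one (x : BrauerAlgebra K p n) :
    mulMap K p n x (basis K p n (Diagram.one n)) = x := by
  induction x using basis_induction with
  | zero => simp
  | add _ _ h h' => simp [h, h']
  | smul _ _ h => simp [h]
  | single G =>
  rw [mulMap_basis, (one_comp n G).1, (one_comp n G).2, pow_zero, one_smul]

theorem one_mulMap (x : BrauerAlgebra K p n) :
    mulMap K p n (basis K p n (Diagram.one n)) x = x := by
  induction x using basis_induction with
  | zero => simp
  | add _ _ h h' => simp [h, h']
  | smul _ _ h => simp [h]
  | single G =>
  rw [mulMap_basis, (comp_one n G).1, (comp_one n G).2, pow_zero, one_smul]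

noncomputable instance : Ring (BrauerAlgebra K p n) :=
  { (inferInstance : AddCommGroup (BrauerAlgebra K p n)) with
    mul := fun x y => mulMap K p n x y
    one := basis K p n (Diagram.one n)
    left_distrib := fun x y z => map_add (mulMap K p n x) y z
    right_distrib := fun x y z => LinearMap.map_add₂ (mulMap K p n) x y z
    zero_mul := fun x => LinearMap.map_zero₂ (mulMap K p n) x
    mul_zero := fun x => map_zero (mulMap K p n x)
    mul_assoc := mulMap_assoc K p n
    one_mul := one_mulMap K p n
    mul_one := mulMap_one K p n }

noncomputable instance : Algebra K (BrauerAlgebra K p n) :=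
  Algebra.ofModule (fun c x y => LinearMap.map_smul₂ (mulMap K p n) c x y)
    (fun c x y => map_smul (mulMap K p n x) c y)

end BrauerAlgebra

/-- The identification of `Fin (p ^ n)` with the sequences of length `n` of elements of `Fin p`
in lexicographic order. -/
noncomputable def lexSeq (p n : ℕ) : Fin (p ^ n) ≃o Lex (Fin n → Fin p) :=
  Fintype.orderIsoFinOfCardEq (Lex (Fin n → Fin p)) (by
    rw [Fintype.card_congr ofLex, Fintype.card_fun, Fintype.card_fin, Fintype.card_fin])

/-- `i(k)`, for `i` the number of a sequence. -/
noncomputable def digit {p n : ℕ} (i : Fin (p ^ n)) (k : Fin n) : Fin p := ofLex (lexSeq p n i) k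

namespace Diagram

/-- The set of threads of a diagram. -/
def threads {m n : ℕ} (D : Diagram m n) : Finset (Sym2 (Fin m ⊕ Fin n)) :=
  Finset.univ.image fun x => s(x, D.link x)

/-- The product of scalar products associated with an `n`-diagram: one factor for every thread,
where the vertices of the top row stand for the vectors `x 0, …, x (n - 1)` and those of the bottom
row for `y 0, …, y (n - 1)`. -/
def invariant {K : Type u} [Field K] {p n : ℕ} (D : Diagram n n) (x y : Fin n → Fin p → K) : K :=
  ∏ t ∈ D.threads, Sym2.lift
    ⟨fun a b => dotProduct (Sum.elim x y a) (Sum.elim x y b), fun _ _ => dotProduct_comm _ _⟩ t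

/-- `b` is the matrix extracted from the invariant of `D`, i.e. the invariant is
`∑ b i j * x 0 (i 0) ⋯ x (n-1) (i (n-1)) * y 0 (j 0) ⋯ y (n-1) (j (n-1))`. -/
def IsExtracted {K : Type u} [Field K] {p n : ℕ} (D : Diagram n n)
    (b : Matrix (Fin (p ^ n)) (Fin (p ^ n)) K) : Prop :=
  ∀ x y : Fin n → Fin p → K, D.invariant x y =
    ∑ i, ∑ j, b i j * (∏ k, x k (digit i k)) * ∏ k, y k (digit j k)

/-- Brauer's matrix of an `n`-diagram: `b i j` is 1 if the sequence `i` above the sequence `j`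
accepts `D`, and 0 otherwise. -/
noncomputable def brauerMatrix (K : Type u) [Field K] (p : ℕ) {n : ℕ} (D : Diagram n n) :
    Matrix (Fin (p ^ n)) (Fin (p ^ n)) K :=
  fun i j => if D.Accepts (digit i) (digit j) then 1 else 0

end Diagram

/-- The linear extension to Brauer's algebra of Brauer's function from `n`-diagrams to matrices. -/
noncomputable def brauerMap (K : Type u) [Field K] (p n : ℕ) :
    BrauerAlgebra K p n →ₗ[K] Matrix (Fin (p ^ n)) (Fin (p ^ n)) K :=
  (BrauerAlgebra.basis K p n).constr K fun D => D.brauerMatrix K p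

/-! ### The two functors given by freeness -/

/-- The unique strict functor from the free symmetric self-adjunction to diagrams with `gen ↦ 0`. -/
noncomputable def linkFunctor (p : ℕ) : FreeSSA ⥤ Br p := FreeSSA.lift (Br.ssa p) ⟨0⟩

/-- The unique strict functor from the free symmetric self-adjunction to matrices with `gen ↦ 1`. -/
def matFunctor (K : Type u) [Field K] (p : ℕ) : FreeSSA ⥤ MatCat K := FreeSSA.lift (matSSA K p) ⟨1⟩

/-- The matrix `R f`, once it is known that `R` maps `n` to `p ^ n`. -/
def matrixOf {K : Type u} [Field K] {p : ℕ} (R : Br p ⥤ MatCat K)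
    (hR : ∀ n, (R.obj ⟨n⟩).dim = p ^ n) {m n : ℕ} (f : (⟨m⟩ : Br p) ⟶ ⟨n⟩) :
    Matrix (Fin (p ^ n)) (Fin (p ^ m)) K :=
  Matrix.reindex (finCongr (hR n)) (finCongr (hR m))
    (show Matrix (Fin (R.obj ⟨n⟩).dim) (Fin (R.obj ⟨m⟩).dim) K from R.map f)

end BrauerRep

open CategoryTheory BrauerRep

/-! The heart of the matter is that `linkFunctor p` is bijective on arrows when `p ≥ 2` and still
surjective for every `p`. A thread at the top of an arrow can be bent down by the self-adjunction
(`FreeSSA.fmap_cup_comp_cap`), so it suffices to treat arrows out of the generator, that is,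
diagrams with empty top row. Such an arrow has a normal form: some circles, then cups put in one
after the other, where each new cup starts at the first vertex and its other end is moved to the
right across some of the threads present. Every arrow is a word in elementary crossings, caps and
cups, and a normal form followed by one such letter is again equal to a normal form (`normal_cross`,
`normal_cap`, `normal_cup`).

A normal form can be read off from its image. The partner of the first vertex determines the last
move; undoing this move leaves an arrow that ends in a cup, and the cup can be cancelled; at the end
the coefficient `p ^ k` determines the number of circles when `p ≥ 2`. This gives
`Normal.map_injective`, and the same procedure applied to an arbitrary diagram gives
`Normal.exists_map`. Identities between scaled diagrams are tested on matrices of labellings by two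
labels, which determine both the diagram and the number of circles (`Diagram.colM_injective`),
whatever `p` is.

The functor `R` is not defined through the inverse of `linkFunctor p`, which would leave out `p =
1`. It is the explicit `diagFunctor`: coefficient times the 0/1-matrix of accepted labellings by `p`
labels. It is a functor because summing over the labels of the middle row counts one factor `p` for
each circle; it is strict, so its composite with `linkFunctor p` is `matFunctor K p` by freeness.
Uniqueness follows from surjectivity of `linkFunctor p` on objects and arrows
(`linkFunctor_cancel`).

With this description `R D` is the transpose of Brauer's matrix once the numbering of sequences
produced by `p ⊗ _` is seen to be lexicographic (`tensorSeq_cast`). The invariant of `D` expands by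
distributivity into a sum over labellings that are constant on threads (`prod_pairs_eq_sum`), and
evaluation at standard basis vectors recovers each coefficient. Functoriality of `R` then gives the
homomorphism on Brauer's algebra. -/

namespace BrauerRep

namespace FreeSSA

/-! ### Equations in the free symmetric self-adjunction -/

/-- The action of the endofunctor on arrows. -/
def fmap {a b : FreeSSA} (f : a ⟶ b) : a.app ⟶ b.app := functor.map f

def capHom (a : FreeSSA) : a.app.app ⟶ a := ⟦Term.φ a⟧

def cupHom (a : FreeSSA) : a ⟶ a.app.app := ⟦Term.γ a⟧

def crossHom (a : FreeSSA) : a.app.app ⟶ a.app.app := ⟦Term.χ a⟧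

theorem fmap_id (a : FreeSSA) : fmap (𝟙 a) = 𝟙 a.app := functor.map_id a

theorem fmap_comp {a b c : FreeSSA} (f : a ⟶ b) (g : b ⟶ c) :
    fmap (f ≫ g) = fmap f ≫ fmap g := functor.map_comp f g

theorem capHom_nat {a b : FreeSSA} (f : a ⟶ b) :
    fmap (fmap f) ≫ capHom b = capHom a ≫ f := ssa.adj.counit.naturality f

theorem cupHom_nat {a b : FreeSSA} (f : a ⟶ b) :
    f ≫ cupHom b = cupHom a ≫ fmap (fmap f) := ssa.adj.unit.naturality f

theorem crossHom_nat {a b : FreeSSA} (f : a ⟶ b) :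
    fmap (fmap f) ≫ crossHom b = crossHom a ≫ fmap (fmap f) := ssa.χ.naturality f

theorem fmap_cupHom_capHom (a : FreeSSA) : fmap (cupHom a) ≫ capHom a.app = 𝟙 a.app :=
  ssa.adj.left_triangle_components a

theorem cupHom_fmap_capHom (a : FreeSSA) : cupHom a.app ≫ fmap (capHom a) = 𝟙 a.app :=
  ssa.adj.right_triangle_components a

theorem crossHom_crossHom (a : FreeSSA) : crossHom a ≫ crossHom a = 𝟙 a.app.app := ssa.χ_χ a

theorem crossHom_braid (a : FreeSSA) :
    crossHom a.app ≫ fmap (crossHom a) ≫ crossHom a.app =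
      fmap (crossHom a) ≫ crossHom a.app ≫ fmap (crossHom a) := ssa.braid a

theorem crossHom_capHom (a : FreeSSA) : crossHom a ≫ capHom a = capHom a := ssa.χ_φ a

theorem cupHom_crossHom (a : FreeSSA) : cupHom a ≫ crossHom a = cupHom a := ssa.γ_χ a

theorem crossHom_capHom_slide (a : FreeSSA) :
    fmap (crossHom a) ≫ capHom a.app = crossHom a.app ≫ fmap (capHom a) := ssa.χ_φ_slide a

theorem cupHom_crossHom_slide (a : FreeSSA) :
    fmap (cupHom a) ≫ crossHom a.app = cupHom a.app ≫ fmap (crossHom a) := ssa.γ_χ_slide a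

/-! ### Normal forms of arrows from the generator -/

/-- A crossing of two neighbouring threads. -/
inductive Cross : FreeSSA → Type
  | here (a : FreeSSA) : Cross a.app.app
  | map {a : FreeSSA} (s : Cross a) : Cross a.app

def Cross.hom : ∀ {a : FreeSSA}, Cross a → (a ⟶ a)
  | _, .here a => crossHom a
  | _, .map s => fmap s.hom

/-- A cap that links two neighbouring vertices. -/
inductive Cap : FreeSSA → FreeSSA → Type
  | here (a : FreeSSA) : Cap a.app.app a
  | map {a b : FreeSSA} (s : Cap a b) : Cap a.app b.app

def Cap.hom : ∀ {a b : FreeSSA}, Cap a b → (a ⟶ b)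
  | _, _, .here a => capHom a
  | _, _, .map s => fmap s.hom

/-- A cup that links two neighbouring vertices. -/
inductive Cup : FreeSSA → FreeSSA → Type
  | here (a : FreeSSA) : Cup a a.app.app
  | map {a b : FreeSSA} (s : Cup a b) : Cup a.app b.app

def Cup.hom : ∀ {a b : FreeSSA}, Cup a b → (a ⟶ b)
  | _, _, .here a => cupHom a
  | _, _, .map s => fmap s.hom

/-- A move of the first thread of `F a` to the right across some of the threads of `a`. -/
inductive Move : FreeSSA → Type
  | id (a : FreeSSA) : Move a
  | step {a : FreeSSA} (c : Move a) : Move a.app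

def Move.hom : ∀ {a : FreeSSA}, Move a → (a.app ⟶ a.app)
  | _, .id a => 𝟙 a.app
  | _, .step (a := a) c => crossHom a ≫ fmap c.hom

/-- Composites of crossings. -/
inductive IsPerm : ∀ {a : FreeSSA}, (a ⟶ a) → Prop
  | id (a : FreeSSA) : IsPerm (𝟙 a)
  | comp {a : FreeSSA} (s : Cross a) {f : a ⟶ a} : IsPerm f → IsPerm (s.hom ≫ f)

theorem IsPerm.cross {a : FreeSSA} (s : Cross a) : IsPerm s.hom := by
  simpa using IsPerm.comp s (IsPerm.id a)

theorem IsPerm.trans {a : FreeSSA} {f g : a ⟶ a} (hf : IsPerm f) :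
    IsPerm g → IsPerm (f ≫ g) := by
  intro hg
  induction hf with
  | id => simpa using hg
  | comp s _ ih => rw [Category.assoc]; exact .comp s ih

theorem IsPerm.map {a : FreeSSA} {f : a ⟶ a} (hf : IsPerm f) : IsPerm (fmap f) := by
  induction hf with
  | id => rw [fmap_id]; exact .id _
  | comp s _ ih => rw [fmap_comp]; exact ih.comp s.map

theorem Move.isPerm : ∀ {a : FreeSSA} (c : Move a), IsPerm c.hom
  | _, .id _ => .id _
  | _, .step c => (c.isPerm.map).comp (.here _)

/-- A crossing that involves the moved thread at its final place lengthens or shortens the move by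
one step. Any other crossing involves only threads of `a` and can be carried out before the move: by
the braid equation if the moved thread has passed both of its threads, by naturality as the
recursion peels off steps. -/
theorem move_cross : ∀ {a : FreeSSA} (c : Move a) (s : Cross a.app),
    ∃ c' : Move a, c.hom ≫ s.hom = c'.hom ∨ ∃ s' : Cross a, c.hom ≫ s.hom = fmap s'.hom ≫ c'.hom
  | _, .id _, .here a => ⟨.step (.id _), .inl (by simp [Move.hom, Cross.hom, fmap_id])⟩
  | _, .step (.id a), .here _ =>
    ⟨.id _, .inl (by simp [Move.hom, Cross.hom, fmap_id, crossHom_crossHom])⟩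
  | _, .step (.step (a := a) c), .here _ => ⟨.step (.step c), .inr ⟨.here _, by
      simp only [Move.hom, Cross.hom, fmap_comp, Category.assoc]
      rw [crossHom_nat, ← reassoc_of% crossHom_braid]⟩⟩
  | _, .id _, .map s => ⟨.id _, .inr ⟨s, by simp [Move.hom, Cross.hom]⟩⟩
  | _, .step c, .map s => by
    obtain ⟨c', h | ⟨s', h⟩⟩ := move_cross c s
    · exact ⟨.step c', .inl (by
        simp only [Move.hom, Cross.hom, Category.assoc, ← fmap_comp, h])⟩
    · refine ⟨.step c', .inr ⟨.map s', ?_⟩⟩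
      simp only [Move.hom, Cross.hom, Category.assoc, ← fmap_comp, h]
      rw [fmap_comp, ← reassoc_of% crossHom_nat]

/-- Two moves send the first two threads to two places. The same permutation arises if these threads
are first crossed and then exchange the places they are sent to. -/
theorem move_move : ∀ {a : FreeSSA} (c : Move a) (d : Move a.app),
    ∃ (c' : Move a) (d' : Move a.app),
      fmap c.hom ≫ d.hom = crossHom a ≫ fmap c'.hom ≫ d'.hom
  | _, c, .id _ => ⟨.id _, .step c, by
      simp only [Move.hom, fmap_id, Category.comp_id, Category.id_comp]
      rw [reassoc_of% crossHom_crossHom]⟩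
  | _, .id _, .step d => ⟨d, .id _, by
      simp only [Move.hom, fmap_id, Category.comp_id, Category.id_comp]⟩
  | _, .step (a := a) c, .step d => by
    obtain ⟨c', d', h⟩ := move_move c d
    refine ⟨.step c', .step d', ?_⟩
    simp only [Move.hom, fmap_comp, Category.assoc]
    rw [reassoc_of% crossHom_nat, ← fmap_comp, h, fmap_comp, fmap_comp,
      ← reassoc_of% crossHom_braid, ← reassoc_of% crossHom_nat]

/-- Two cases: the cap avoids the moved thread and can be put before the move, or the moved thread
is one of its ends. In the second case the thread may stay at the front and the others are permuted
so that its partner comes next to it. The equations of objects and `eqToHom` are there because `b`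
is a variable index; they become `rfl` in each case. -/
theorem move_cap : ∀ {a b : FreeSSA} (c : Move a) (s : Cap a.app b),
    (∃ (d : FreeSSA) (hd : b = d.app) (c' : Move d) (s' : Cap a d),
      c.hom ≫ s.hom = fmap s'.hom ≫ c'.hom ≫ eqToHom hd.symm) ∨
    ∃ (hd : a = b.app) (f : a ⟶ a), IsPerm f ∧
      c.hom ≫ s.hom = fmap (f ≫ eqToHom hd) ≫ capHom b
  | _, _, .id _, .here a => .inr ⟨rfl, 𝟙 _, .id _, by simp [Move.hom, Cap.hom, fmap_id]⟩
  | _, _, .step (.id _), .here _ =>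
    .inr ⟨rfl, 𝟙 _, .id _, by simp [Move.hom, Cap.hom, fmap_id, crossHom_capHom]⟩
  | _, _, .step (.step c), .here _ => .inl ⟨_, rfl, c, .here _, by
      simp only [Move.hom, Cap.hom, fmap_comp, Category.assoc, eqToHom_refl, Category.comp_id]
      rw [capHom_nat, reassoc_of% crossHom_capHom_slide, reassoc_of% crossHom_crossHom]⟩
  | _, _, .id _, .map s => .inl ⟨_, rfl, .id _, s, by simp [Move.hom, Cap.hom]⟩
  | _, _, .step c, .map (b := b) s => by
    obtain ⟨d, rfl, c', s', h⟩ | ⟨rfl, f, hf, h⟩ := move_cap c s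
    · refine .inl ⟨_, rfl, .step c', .map s', ?_⟩
      simp only [Move.hom, Cap.hom, Category.assoc, ← fmap_comp, h]
      simp only [eqToHom_refl, Category.comp_id]
      rw [fmap_comp, ← reassoc_of% crossHom_nat]
    -- The thread passed by the first step now lies in front of the partner, so one more crossing is
    -- needed to bring the partner to the front; the slide equation for the cap supplies it.
    · refine .inr ⟨rfl, fmap f ≫ crossHom _, hf.map.trans (IsPerm.cross (.here b)), ?_⟩
      simp only [Move.hom, Cap.hom, Category.assoc, ← fmap_comp, h]
      simp only [eqToHom_refl, Category.comp_id, fmap_comp, Category.assoc]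
      rw [crossHom_capHom_slide, reassoc_of% crossHom_nat]

/-- The moved thread is never an end of the new cup, so the cup always goes first. If it is inserted
in front of everything, the move has to pass its two ends as well, hence the two extra steps. -/
theorem move_cup : ∀ {a b : FreeSSA} (c : Move a) (s : Cup a.app b),
    ∃ (d : FreeSSA) (hd : b = d.app) (c' : Move d) (s' : Cup a d),
      c.hom ≫ s.hom = fmap s'.hom ≫ c'.hom ≫ eqToHom hd.symm
  | a, _, c, .here _ => ⟨_, rfl, .step (.step c), .here _, by
      simp only [Move.hom, Cup.hom, fmap_comp, eqToHom_refl, Category.comp_id]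
      rw [cupHom_nat, reassoc_of% cupHom_crossHom_slide, ← reassoc_of% fmap_comp,
        crossHom_crossHom, fmap_id, Category.id_comp]⟩
  | _, _, .id _, .map s => ⟨_, rfl, .id _, s, by simp [Move.hom, Cup.hom]⟩
  | _, _, .step c, .map s => by
    obtain ⟨d, rfl, c', s', h⟩ := move_cup c s
    refine ⟨_, rfl, .step c', .map s', ?_⟩
    simp only [Move.hom, Cup.hom, Category.assoc, ← fmap_comp, h]
    simp only [eqToHom_refl, Category.comp_id]
    rw [fmap_comp, ← reassoc_of% crossHom_nat]

/-- The circle. -/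
def circle : gen ⟶ gen := cupHom gen ≫ capHom gen

/-- Normal forms of the arrows from the generator: some circles, and a cup from the first vertex to
another vertex below a normal form. -/
inductive Normal : FreeSSA → Type
  | circles (k : ℕ) : Normal gen
  | cup {a : FreeSSA} (c : Move a) (f : Normal a) : Normal a.app.app

def circlePow : ℕ → (gen ⟶ gen)
  | 0 => 𝟙 gen
  | k + 1 => circle ≫ circlePow k

def Normal.hom : ∀ {a : FreeSSA}, Normal a → (gen ⟶ a)
  | _, .circles k => circlePow k
  | _, .cup (a := a) c f => f.hom ≫ cupHom a ≫ fmap c.hom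

/-- The crossing meets the last cup in one of three ways: it joins both ends of this cup and is
absorbed; it exchanges the first vertex with the first vertex of the preceding cup; or it avoids the
first vertex and `move_cross` applies. -/
theorem normal_cross : ∀ {a : FreeSSA} (f : Normal a) (s : Cross a),
    ∃ f' : Normal a, f.hom ≫ s.hom = f'.hom
  | _, .cup (.id _) f, .here _ => ⟨.cup (.id _) f, by
      simp [Normal.hom, Move.hom, Cross.hom, cupHom_crossHom, fmap_id]⟩
  -- The first two vertices belong to different cups, and the crossing exchanges their partners. By
  -- `move_move` the places of the other two ends are `c'` and `d'` in exchanged roles; the `step`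
  -- in front of `d'` passes the second vertex.
  | _, .cup (a := .app (.app a)) (.step c) (.cup d f), .here _ => by
    obtain ⟨c', d', h⟩ := move_move d c
    refine ⟨.cup (.step d') (.cup c' f), ?_⟩
    simp only [Normal.hom, Move.hom, Cross.hom, Category.assoc, fmap_comp]
    rw [crossHom_nat, ← reassoc_of% cupHom_crossHom_slide, reassoc_of% crossHom_crossHom]
    rw [← reassoc_of% fmap_comp d.hom, cupHom_nat, fmap_comp, Category.assoc, ← fmap_comp,
      ← fmap_comp (fmap d.hom), h, reassoc_of% cupHom_nat (fmap c'.hom),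
      ← reassoc_of% fmap_comp (fmap (fmap c'.hom)), crossHom_nat]
    simp only [fmap_comp, Category.assoc]
    rw [reassoc_of% cupHom_nat (cupHom a), ← reassoc_of% fmap_comp (fmap (cupHom a)),
      cupHom_crossHom_slide]
    simp only [fmap_comp, Category.assoc]
  | _, .cup c f, .map s => by
    obtain ⟨c', h | ⟨s', h⟩⟩ := move_cross c s
    · exact ⟨.cup c' f, by simp only [Normal.hom, Cross.hom, Category.assoc, ← fmap_comp, h]⟩
    · obtain ⟨f', hf⟩ := normal_cross f s'
      refine ⟨.cup c' f', ?_⟩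
      simp only [Normal.hom, Cross.hom, Category.assoc, ← fmap_comp, h, ← hf]
      rw [fmap_comp, ← reassoc_of% cupHom_nat]

theorem normal_perm {a : FreeSSA} {g : a ⟶ a} (hg : IsPerm g) (f : Normal a) :
    ∃ f' : Normal a, f.hom ≫ g = f'.hom := by
  induction hg generalizing f with
  | id => exact ⟨f, Category.comp_id _⟩
  | comp s _ ih =>
    obtain ⟨f', h⟩ := normal_cross f s
    obtain ⟨f'', h'⟩ := ih f'
    exact ⟨f'', by rw [← h', ← h, Category.assoc]⟩

theorem circle_normal : ∀ {a : FreeSSA} (f : Normal a), ∃ f' : Normal a, circle ≫ f.hom = f'.hom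
  | _, .circles k => ⟨.circles (k + 1), rfl⟩
  | _, .cup c f => by
    obtain ⟨f', h⟩ := circle_normal f
    exact ⟨.cup c f', by simp only [Normal.hom, ← h, Category.assoc]⟩

/-- If the cap closes the last cup, a circle arises, and naturality moves it down to the generator.
If it touches exactly one end of this cup, a triangular equation straightens the zigzag and leaves
`f` followed by crossings, whence `normal_perm`. If it touches neither end, it passes the cup and
acts on `f`. -/
theorem normal_cap : ∀ {a b : FreeSSA} (f : Normal a) (s : Cap a b),
    ∃ f' : Normal b, f.hom ≫ s.hom = f'.hom
  | _, _, .cup (.id _) f, .here _ => by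
    obtain ⟨f', h⟩ := circle_normal f
    refine ⟨f', ?_⟩
    rw [← h]
    simp only [Normal.hom, Move.hom, Cap.hom, fmap_id, Category.id_comp, Category.assoc, circle]
    rw [reassoc_of% cupHom_nat, capHom_nat]
  | _, _, .cup (.step c) f, .here _ => by
    obtain ⟨f', h⟩ := normal_perm c.isPerm f
    refine ⟨f', ?_⟩
    rw [← h]
    simp only [Normal.hom, Move.hom, Cap.hom, fmap_comp, Category.assoc]
    rw [capHom_nat, ← reassoc_of% cupHom_crossHom_slide, reassoc_of% crossHom_capHom,
      reassoc_of% fmap_cupHom_capHom]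
  | _, _, .cup c f, .map s => by
    obtain ⟨d, rfl, c', s', h⟩ | ⟨rfl, g, hg, h⟩ := move_cap c s
    · obtain ⟨f', hf⟩ := normal_cap f s'
      refine ⟨.cup c' f', ?_⟩
      simp only [eqToHom_refl, Category.comp_id] at h
      simp only [Normal.hom, Cap.hom, Category.assoc, ← fmap_comp, h, ← hf]
      rw [fmap_comp, ← reassoc_of% cupHom_nat]
    · obtain ⟨f', hf⟩ := normal_perm hg f
      refine ⟨f', ?_⟩
      simp only [eqToHom_refl, Category.comp_id] at h
      simp only [Normal.hom, Cap.hom, Category.assoc, ← fmap_comp, h, ← hf]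
      rw [fmap_comp, ← reassoc_of% cupHom_nat, cupHom_fmap_capHom, Category.comp_id]

theorem normal_cup : ∀ {a b : FreeSSA} (f : Normal a) (s : Cup a b),
    ∃ f' : Normal b, f.hom ≫ s.hom = f'.hom
  | _, _, f, .here _ => ⟨.cup (.id _) f, by
      simp [Normal.hom, Move.hom, Cup.hom, fmap_id]⟩
  | _, _, .cup c f, .map s => by
    obtain ⟨d, rfl, c', s', h⟩ := move_cup c s
    obtain ⟨f', hf⟩ := normal_cup f s'
    refine ⟨.cup c' f', ?_⟩
    simp only [eqToHom_refl, Category.comp_id] at h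
    simp only [Normal.hom, Cup.hom, Category.assoc, ← fmap_comp, h, ← hf]
    rw [fmap_comp, ← reassoc_of% cupHom_nat]

/-! ### Every arrow from the generator has a normal form -/

/-- Composites of crossings, caps and cups. -/
inductive IsWord : ∀ {a b : FreeSSA}, (a ⟶ b) → Prop
  | id (a : FreeSSA) : IsWord (𝟙 a)
  | cross {a b : FreeSSA} (s : Cross a) {f : a ⟶ b} : IsWord f → IsWord (s.hom ≫ f)
  | cap {a b c : FreeSSA} (s : Cap a b) {f : b ⟶ c} : IsWord f → IsWord (s.hom ≫ f)
  | cup {a b c : FreeSSA} (s : Cup a b) {f : b ⟶ c} : IsWord f → IsWord (s.hom ≫ f)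

theorem IsWord.trans {a b c : FreeSSA} {f : a ⟶ b} {g : b ⟶ c} (hf : IsWord f) :
    IsWord g → IsWord (f ≫ g) := by
  intro hg
  induction hf with
  | id => simpa using hg
  | cross s _ ih => rw [Category.assoc]; exact .cross s (ih hg)
  | cap s _ ih => rw [Category.assoc]; exact .cap s (ih hg)
  | cup s _ ih => rw [Category.assoc]; exact .cup s (ih hg)

theorem IsWord.map {a b : FreeSSA} {f : a ⟶ b} (hf : IsWord f) : IsWord (fmap f) := by
  induction hf with
  | id => rw [fmap_id]; exact .id _
  | cross s _ ih => rw [fmap_comp]; exact ih.cross s.map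
  | cap s _ ih => rw [fmap_comp]; exact ih.cap s.map
  | cup s _ ih => rw [fmap_comp]; exact ih.cup s.map

theorem isWord_term {a b : FreeSSA} (t : Term a b) : IsWord (⟦t⟧ : a ⟶ b) := by
  induction t with
  | id a => exact .id a
  | comp f g ihf ihg => exact ihf.trans ihg
  | map f ih => exact ih.map
  | φ a =>
    have h := IsWord.cap (.here a) (.id _)
    rwa [Category.comp_id] at h
  | γ a =>
    have h := IsWord.cup (.here a) (.id _)
    rwa [Category.comp_id] at h
  | χ a =>
    have h := IsWord.cross (.here a) (.id _)
    rwa [Category.comp_id] at h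

theorem normal_word {a b : FreeSSA} {g : a ⟶ b} (hg : IsWord g) (f : Normal a) :
    ∃ f' : Normal b, f.hom ≫ g = f'.hom := by
  induction hg with
  | id => exact ⟨f, Category.comp_id _⟩
  | cross s _ ih =>
    obtain ⟨f', h⟩ := normal_cross f s
    obtain ⟨f'', h'⟩ := ih f'
    exact ⟨f'', by rw [← h', ← h, Category.assoc]⟩
  | cap s _ ih =>
    obtain ⟨f', h⟩ := normal_cap f s
    obtain ⟨f'', h'⟩ := ih f'
    exact ⟨f'', by rw [← h', ← h, Category.assoc]⟩
  | cup s _ ih =>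
    obtain ⟨f', h⟩ := normal_cup f s
    obtain ⟨f'', h'⟩ := ih f'
    exact ⟨f'', by rw [← h', ← h, Category.assoc]⟩

/-- The identity of the generator is the normal form with no circles; the letters of a word for `f`
are absorbed into it one by one. -/
theorem exists_normal {a : FreeSSA} (f : gen ⟶ a) : ∃ f' : Normal a, f = f'.hom := by
  induction f using Quotient.inductionOn with
  | h t =>
    obtain ⟨f', h⟩ := normal_word (isWord_term t) (.circles 0)
    exact ⟨f', (Category.id_comp _).symm.trans h⟩

end FreeSSA
end BrauerRep

namespace BrauerRep

/-! ### Threads of composite diagrams -/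

/-- The closed thread can carry any label, independently of the rest: this is the value of a circle.
-/
theorem capM_mul_cupM {R : Type*} [CommSemiring R] {Q : Type*} [Fintype Q] [DecidableEq Q]
    {O : Type*} {X : O → Type*} [∀ o, Fintype (X o)] [∀ o, DecidableEq (X o)]
    {s : O → O} (e : ∀ o, X (s o) ≃ Q × X o) (o : O) :
    capM R e o * cupM R e o = Fintype.card Q • (1 : Matrix (X o) (X o) R) := by
  ext j i
  simp [capM, cupM, Matrix.mul_apply, Matrix.one_apply, Matrix.smul_apply, sumX e, ite_and, eq_comm]

namespace Diagram

variable {m n q : ℕ} {D : Diagram m n} {E : Diagram n q}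

theorem glue_upper (D : Diagram m n) (E : Diagram n q) (x : Fin m ⊕ Fin n) :
    (glue D E).Reachable (upper m n q x) (upper m n q (D.link x)) :=
  SimpleGraph.Adj.reachable (Or.inl ⟨x, rfl, rfl⟩)

theorem glue_lower (D : Diagram m n) (E : Diagram n q) (x : Fin n ⊕ Fin q) :
    (glue D E).Reachable (lower m n q x) (lower m n q (E.link x)) :=
  SimpleGraph.Adj.reachable (Or.inr ⟨x, rfl, rfl⟩)

theorem comp_link_inl {i : Fin m} {j : Fin n} {k : Fin q} (hD : D.link (.inl i) = .inr j)
    (hE : E.link (.inl j) = .inr k) : (D.comp E).link (.inl i) = .inr k := by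
  refine (comp_link_eq D E _ _ (by simp) ?_).symm
  have h1 := glue_upper D E (.inl i)
  have h2 := glue_lower D E (.inl j)
  rw [hD] at h1
  rw [hE] at h2
  exact h1.trans h2

theorem comp_link_inr {i j : Fin n} {i' j' : Fin q} (hD : D.link (.inr i) = .inr j)
    (hi : E.link (.inl i) = .inr i') (hj : E.link (.inl j) = .inr j') :
    (D.comp E).link (.inr i') = .inr j' := by
  refine (comp_link_eq D E _ _ ?_ ?_).symm
  -- If the two end points coincided, following their threads back would show that `D` links a
  -- vertex to itself.
  · intro h
    rw [Sum.inr_injective h] at hj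
    have h' := congrArg E.link (hj.trans hi.symm)
    rw [E.link_link, E.link_link, Sum.inl.injEq] at h'
    rw [h'] at hD
    exact D.link_ne _ hD
  · have h1 := glue_upper D E (.inr i)
    have h2 := glue_lower D E (.inl i)
    have h3 := glue_lower D E (.inl j)
    rw [hD] at h1
    rw [hi] at h2
    rw [hj] at h3
    exact h2.symm.trans (h1.trans h3)

theorem comp_link_of_lower {i j : Fin q} (hE : E.link (.inr i) = .inr j) :
    (D.comp E).link (.inr i) = .inr j := by
  refine (comp_link_eq D E _ _ ?_ ?_).symm
  · intro h
    exact E.link_ne _ (hE.trans (congrArg Sum.inr (Sum.inr_injective h)))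
  · have h := glue_lower D E (.inr i)
    rw [hE] at h
    exact h

theorem cross_link_zero (n : ℕ) : (cross n).link (.inl 0) = .inr 1 := by
  simp [cross]

theorem cross_link_one (n : ℕ) : (cross n).link (.inl 1) = .inr 0 := by
  simp [cross]

theorem pad_link_zero (D : Diagram m n) : D.pad.link (.inl 0) = .inr 0 := rfl

theorem pad_link_succ {i : Fin m} {j : Fin n} (h : D.link (.inl i) = .inr j) :
    D.pad.link (.inl i.succ) = .inr j.succ :=
  (congrArg (Sum.map Fin.succ Fin.succ) h : _)

theorem cup_link_zero (n : ℕ) : (cup n).link (.inr 0) = .inr 1 := rfl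

theorem exists_link_zero {n : ℕ} (D : Diagram 0 (n + 1)) :
    ∃ j : Fin n, D.link (.inr 0) = .inr j.succ := by
  rcases hx : D.link (.inr 0) with x | x
  · exact x.elim0
  · obtain ⟨j, rfl⟩ := Fin.exists_succ_eq.2 fun h => D.link_ne _ (hx.trans (congrArg Sum.inr h))
    exact ⟨j, rfl⟩

/-- Each vertex of the middle row is joined to the bottom row by a vertical thread of the cup
diagram, so every component reaches an outer vertex. -/
theorem circles_cup (D : Diagram m n) : circles D (cup n) = 0 := by
  rw [circles, Nat.card_eq_zero]
  refine Or.inl ⟨?_⟩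
  rintro ⟨c, hc⟩
  induction c using SimpleGraph.ConnectedComponent.ind with
  | h v =>
  rcases v with v | v | v
  · exact hc (.inl v) rfl
  · exact hc (.inr v.succ.succ) (SimpleGraph.ConnectedComponent.sound
      (glue_lower D (cup n) (.inl v)).symm)
  · exact hc (.inr v) rfl

/-- The cap closes the thread between the first two vertices to a circle, which counts `t`, and the
cup restores this thread. -/
theorem cupM_mul_capM_of_link {n : ℕ} {D : Diagram 0 (n + 2)} (h : D.link (.inr 0) = .inr 1)
    (t : ℕ) : colM t (cup n) * (colM t (cap n) * colM t D) = t • colM t D := by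
  have hacc : ∀ (i : Fin 0 → Fin t) (j : Fin (n + 2) → Fin t), D.Accepts i j ↔
      j 0 = j 1 ∧ ∀ x : Fin n, Sum.elim i j (D.link (.inr x.succ.succ)) = j x.succ.succ := by
    intro i j
    have h' : D.link (.inr 1) = .inr 0 := by rw [← h, D.link_link]
    constructor
    · intro hD
      have h0 := hD (.inr 0)
      rw [h] at h0
      exact ⟨h0.symm, fun x => hD (.inr x.succ.succ)⟩
    · rintro ⟨h0, hs⟩ (x | x)
      · exact x.elim0
      · cases x using Fin.cases with
        | zero => rw [h]; exact h0.symm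
        | succ x =>
          cases x using Fin.cases with
          | zero =>
            rw [Fin.succ_zero_eq_one, h']
            exact h0
          | succ x => exact hs x
  -- The first two vertices are each other's partners, so the remaining ones are linked among
  -- themselves.
  have hlink : ∀ x : Fin n, ∃ y : Fin n, D.link (.inr x.succ.succ) = .inr y.succ.succ := by
    intro x
    rcases hx : D.link (.inr x.succ.succ) with y | y
    · exact y.elim0
    · cases y using Fin.cases with
      | zero =>
        have := congrArg D.link hx
        rw [D.link_link, h] at this
        simp [Fin.ext_iff] at this
      | succ y =>
        cases y using Fin.cases with
        | zero =>
          have := congrArg D.link hx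
          rw [D.link_link, Fin.succ_zero_eq_one, ← h, D.link_link] at this
          simp [Fin.ext_iff] at this
        | succ y => exact ⟨y, rfl⟩
  choose f hf using hlink
  have hacc' : ∀ (i : Fin 0 → Fin t) (a b : Fin t) (j : Fin n → Fin t),
      D.Accepts i ((splitFun t (n + 1)).symm (a, (splitFun t n).symm (b, j))) ↔
        a = b ∧ ∀ x, j (f x) = j x := by
    intro i a b j
    rw [hacc]
    simp only [hf]
    exact Iff.rfl
  rw [colM_cup, colM_cap]
  ext j i
  obtain ⟨⟨a, j⟩, rfl⟩ := (splitFun t (n + 1)).symm.surjective j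
  obtain ⟨⟨b, j⟩, rfl⟩ := (splitFun t n).symm.surjective j
  simp [Matrix.mul_apply, capM, cupM, colM, sumX (X := fun n => Fin n → Fin t)
    (s := fun n => n + 1) (splitFun t), hacc', ite_and]
  refine if_congr Iff.rfl ?_ rfl
  rw [Finset.sum_eq_single j] <;> simp +contextual

end Diagram

/-! ### Cancellation of a cup in the category of diagrams -/

namespace Br

variable {p : ℕ}

theorem scaled_comp_one {m n : ℕ} (k l : ℕ) (D : Diagram m n) :
    (Hom.scaled (p := p) k D).comp (Hom.scaled l (Diagram.one n)) = Hom.scaled (k + l) D := by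
  rw [scaled_comp]
  apply scaled_eq
  rw [colM_scaled_comp, Diagram.colM_one, Matrix.smul_mul, Matrix.one_mul, smul_smul, pow_add,
    mul_comm]

/-- One circle is formed. The test uses two labels, so the circle appears there as the factor `2 = 2
^ 1`; the exponent 1 is what counts for arbitrary `p`. -/
theorem cup_comp_cap (n : ℕ) :
    (Hom.scaled (p := p) 0 (Diagram.cup n)).comp (Hom.scaled 0 (Diagram.cap n)) =
      Hom.scaled 1 (Diagram.one n) := by
  rw [scaled_comp]
  apply scaled_eq
  rw [colM_scaled_comp, Diagram.colM_cup, Diagram.colM_cap, Diagram.colM_one, pow_zero, one_smul,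
    one_smul, pow_one]
  exact (capM_mul_cupM (X := fun n => Fin n → Fin 2) (s := fun n => n + 1) (Diagram.splitFun 2)
    n).trans (by rw [Fintype.card_fin])

theorem exists_comp_cup {n : ℕ} {D : Diagram 0 (n + 2)} (h : D.link (.inr 0) = .inr 1) (k : ℕ) :
    ∃ E : Diagram 0 n, (Hom.scaled (p := p) k E).comp (Hom.scaled 0 (Diagram.cup n)) =
      Hom.scaled k D := by
  -- Only the diagram part of the composite with the cap is used, so the circle which the cap closes
  -- does not enter the coefficient. In `h'` this circle is the factor 2, read as `2 ^ 1` when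
  -- `Diagram.colM_injective` is applied.
  refine ⟨D.comp (Diagram.cap n), ?_⟩
  rw [scaled_comp, Diagram.circles_cup]
  have h' := Diagram.cupM_mul_capM_of_link h 2
  rw [Diagram.colM_mul, Matrix.mul_smul, Diagram.colM_mul, Diagram.circles_cup, pow_zero,
    one_smul] at h'
  rw [zero_add, add_zero, (Diagram.colM_injective (l := 1) h').2]

/-- Composition with a cap turns the cup into a circle and returns `f` and `g` with one more factor
`p`. As `p ≥ 2`, equality of powers of `p` gives equality of exponents. -/
theorem comp_cup_injective (hp : 2 ≤ p) {m n : Br p} {f g : Hom m n}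
    (h : f.comp (Hom.scaled (p := p) 0 (Diagram.cup n.width)) =
      g.comp (Hom.scaled (p := p) 0 (Diagram.cup n.width))) : f = g := by
  have key : ∀ f : m ⟶ n, (f ≫ ofDiagram p (Diagram.cup n.width)) ≫
      ofDiagram p (Diagram.cap n.width) = f.comp (Hom.scaled 1 (Diagram.one n.width)) := by
    intro f
    rw [Category.assoc]
    exact congrArg (fun x => Hom.comp f x) (cup_comp_cap n.width)
  have h' := (key f).symm.trans ((congrArg (fun x => Hom.comp x
    (Hom.scaled (p := p) 0 (Diagram.cap n.width))) h).trans (key g))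
  obtain ⟨k, D, rfl⟩ := f.exists_scaled
  obtain ⟨l, E, rfl⟩ := g.exists_scaled
  rw [scaled_comp_one, scaled_comp_one] at h'
  have hk : k + 1 = l + 1 := Nat.pow_right_injective hp (congrArg Hom.coeff h')
  have hD : D = E := congrArg Hom.diag h'
  rw [hD, Nat.succ_injective hk]

end Br

/-! ### The functor from the free symmetric self-adjunction to diagrams -/

namespace FreeSSA

variable (p : ℕ)

theorem linkFunctor_fmap {a b : FreeSSA} (f : a ⟶ b) :
    (linkFunctor p).map (fmap f) = Br.Hom.pad ((linkFunctor p).map f) :=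
  Quotient.inductionOn f fun _ => rfl

/-- The number of threads over which a move moves the first one. -/
noncomputable def Move.pos : ∀ {a : FreeSSA}, Move a → Fin (((linkFunctor p).obj a).width + 1)
  | _, .id _ => 0
  | _, .step c => (Move.pos c).succ

theorem Move.exists_pos : ∀ (a : FreeSSA) (j : Fin (((linkFunctor p).obj a).width + 1)),
    ∃ c : Move a, c.pos p = j := by
  intro a
  induction a with
  | gen => exact fun j => ⟨.id _, Subsingleton.elim (α := Fin 1) _ _⟩
  | app a ih =>
    intro j
    induction j using Fin.cases with
    | zero => exact ⟨.id _, rfl⟩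
    | succ j =>
      obtain ⟨c, hc⟩ := ih j
      exact ⟨.step c, congrArg Fin.succ hc⟩

theorem Move.pos_injective : ∀ {a : FreeSSA} {c d : Move a}, c.pos p = d.pos p → c = d
  | _, .id _, .id _, _ => rfl
  | _, .id _, .step _, h => absurd h.symm (Fin.succ_ne_zero _)
  | _, .step _, .id _, h => absurd h (Fin.succ_ne_zero _)
  | _, .step _, .step _, h => congrArg Move.step (Move.pos_injective (Fin.succ_injective _ h))

/-- The inverse of a move. -/
def Move.inv : ∀ {a : FreeSSA}, Move a → (a.app ⟶ a.app)
  | _, .id a => 𝟙 a.app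
  | _, .step (a := a) c => fmap c.inv ≫ crossHom a

theorem Move.inv_hom : ∀ {a : FreeSSA} (c : Move a), c.inv ≫ c.hom = 𝟙 a.app
  | _, .id _ => Category.comp_id _
  | _, .step c => by
    simp only [Move.hom, Move.inv, Category.assoc]
    rw [reassoc_of% crossHom_crossHom, ← fmap_comp, c.inv_hom, fmap_id]

theorem Move.hom_inv : ∀ {a : FreeSSA} (c : Move a), c.hom ≫ c.inv = 𝟙 a.app
  | _, .id _ => Category.comp_id _
  | _, .step c => by
    simp only [Move.hom, Move.inv, Category.assoc]
    rw [← reassoc_of% fmap_comp, c.hom_inv, fmap_id, Category.id_comp, crossHom_crossHom]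

theorem Move.link_hom : ∀ {a : FreeSSA} (c : Move a),
    ((linkFunctor p).map c.hom).diag.link
      (.inl (0 : Fin (((linkFunctor p).obj a).width + 1))) = .inr (c.pos p)
  | _, .id _ => rfl
  | _, .step (a := a) c => by
    rw [Move.hom, Functor.map_comp, linkFunctor_fmap]
    exact Diagram.comp_link_inl (Diagram.cross_link_zero _)
      (Diagram.pad_link_succ (c.link_hom))

theorem Move.link_inv : ∀ {a : FreeSSA} (c : Move a),
    ((linkFunctor p).map c.inv).diag.link (.inl (c.pos p)) =
      .inr (0 : Fin (((linkFunctor p).obj a).width + 1))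
  | _, .id _ => rfl
  | _, .step (a := a) c => by
    rw [Move.inv, Functor.map_comp, linkFunctor_fmap]
    exact Diagram.comp_link_inl (Diagram.pad_link_succ (c.link_inv))
      (Diagram.cross_link_one _)

theorem linkFunctor_circlePow (k : ℕ) :
    (linkFunctor p).map (circlePow k) = Br.Hom.scaled (p := p) k (Diagram.one 0) := by
  induction k with
  | zero => rfl
  | succ k ih =>
    rw [circlePow, Functor.map_comp, ih]
    have h : (linkFunctor p).map circle = Br.Hom.scaled (p := p) 1 (Diagram.one 0) :=
      Br.cup_comp_cap 0
    rw [h]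
    exact (Br.scaled_comp_one 1 k (Diagram.one 0)).trans (by rw [add_comm])

variable {p}

/-- The partner of the first vertex is at the place to which the other end of the last cup was
moved, so it determines the move. Composing with the inverse move and cancelling the cup reduces the
claim to shorter normal forms, down to the comparison of `p ^ k` with `p ^ l`. -/
theorem Normal.map_injective (hp : 2 ≤ p) : ∀ {a : FreeSSA} {f g : Normal a},
    (linkFunctor p).map f.hom = (linkFunctor p).map g.hom → f = g
  | _, .circles k, .circles l, h => by
    simp only [Normal.hom, linkFunctor_circlePow] at h
    rw [Nat.pow_right_injective hp (congrArg Br.Hom.coeff h)]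
  | _, .cup (a := a) c f, .cup d g, h => by
    have hlink : ∀ (c : Move a) (f : Normal a),
        ((linkFunctor p).map (Normal.cup c f).hom).diag.link
          (.inr (0 : Fin (((linkFunctor p).obj a).width + 2))) = .inr (c.pos p).succ := by
      intro c f
      rw [Normal.hom, ← Category.assoc, Functor.map_comp, Functor.map_comp, linkFunctor_fmap]
      exact Diagram.comp_link_inr
        (Diagram.comp_link_of_lower (Diagram.cup_link_zero _))
        (Diagram.pad_link_zero _) (Diagram.pad_link_succ (c.link_hom p))
    have hcd : c = d := by
      have := hlink c f
      rw [h] at this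
      have := this.symm.trans (hlink d g)
      exact Move.pos_injective p (Fin.succ_injective _ (Sum.inr_injective this))
    subst hcd
    have hfg : (linkFunctor p).map (f.hom ≫ cupHom a) = (linkFunctor p).map (g.hom ≫ cupHom a) := by
      have h' := congrArg (fun x => x ≫ (linkFunctor p).map (fmap c.inv)) h
      simpa only [← Functor.map_comp, Normal.hom, Category.assoc, ← fmap_comp, c.hom_inv, fmap_id,
        Category.comp_id] using h'
    rw [Functor.map_comp, Functor.map_comp] at hfg
    rw [Normal.map_injective hp (Br.comp_cup_injective hp hfg)]

variable (p) in
-- The normal form is built backwards: the move `c` is chosen by the partner of the first vertex,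
-- its inverse makes the first two vertices partners, and what remains after removal of their cup is
-- a diagram on two vertices less.
theorem Normal.exists_map : ∀ (a : FreeSSA) (k : ℕ) (D : Diagram 0 ((linkFunctor p).obj a).width),
    ∃ f : Normal a, (linkFunctor p).map f.hom = Br.Hom.scaled (p := p) k D
  | .gen, k, D => ⟨.circles k, (linkFunctor_circlePow p k).trans (by
      congr 1
      ext (x | x) <;> exact x.elim0)⟩
  | .app .gen, _, D => by
    -- There is no diagram with a single vertex.
    refine absurd ?_ (D.link_ne (.inr (0 : Fin 1)))
    rcases D.link (.inr (0 : Fin 1)) with x | x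
    · exact x.elim0
    · exact congrArg Sum.inr (Subsingleton.elim (α := Fin 1) _ _)
  | .app (.app a), k, D => by
    obtain ⟨j, hj⟩ : ∃ j : Fin (((linkFunctor p).obj a).width + 1),
        D.link (.inr (0 : Fin (((linkFunctor p).obj a).width + 2))) = .inr j.succ :=
      D.exists_link_zero
    obtain ⟨c, rfl⟩ := Move.exists_pos p a j
    let u : (linkFunctor p).obj gen ⟶ (linkFunctor p).obj a.app.app := Br.Hom.scaled (p := p) k D
    -- The exponent `l` need not be compared with `k`, because the recursion allows every exponent
    -- and `h1` recovers the whole arrow with its coefficient.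
    obtain ⟨l, E, hE⟩ : ∃ (l : ℕ) (E : Diagram 0 (((linkFunctor p).obj a).width + 2)),
        u ≫ (linkFunctor p).map (fmap c.inv) = Br.Hom.scaled (p := p) l E :=
      Br.Hom.exists_scaled (p := p) (m := ⟨0⟩) _
    have hE0 : E.link (.inr 0) = .inr 1 := by
      have h : E = D.comp ((linkFunctor p).map (fmap c.inv)).diag :=
        (congrArg Br.Hom.diag hE).symm
      rw [h, linkFunctor_fmap]
      exact Diagram.comp_link_inr hj (Diagram.pad_link_zero _)
        (Diagram.pad_link_succ (c.link_inv p))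
    obtain ⟨G, hG⟩ := Br.exists_comp_cup (p := p) hE0 l
    obtain ⟨f, hf⟩ := Normal.exists_map a l G
    refine ⟨.cup c f, ?_⟩
    have h1 : (linkFunctor p).map (f.hom ≫ cupHom a) = u ≫ (linkFunctor p).map (fmap c.inv) := by
      rw [Functor.map_comp, hf, hE]
      exact hG
    rw [Normal.hom, ← Category.assoc, Functor.map_comp, h1, Category.assoc, ← Functor.map_comp,
      ← fmap_comp, c.inv_hom, fmap_id]
    exact (congrArg (fun x => u ≫ x) ((linkFunctor p).map_id _)).trans (Category.comp_id u)

/-- Bending the first thread down and up again changes nothing. So an arrow is determined by one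
whose source has one thread less. -/
theorem fmap_cup_comp_cap {a b : FreeSSA} (f : a.app ⟶ b) :
    fmap (cupHom a ≫ fmap f) ≫ capHom b = f := by
  rw [fmap_comp, Category.assoc, capHom_nat, reassoc_of% fmap_cupHom_capHom]

theorem linkFunctor_map_injective (hp : 2 ≤ p) : ∀ {a b : FreeSSA} {f g : a ⟶ b},
    (linkFunctor p).map f = (linkFunctor p).map g → f = g
  | .gen, _, f, g, h => by
    obtain ⟨f, rfl⟩ := exists_normal f
    obtain ⟨g, rfl⟩ := exists_normal g
    rw [Normal.map_injective hp h]
  | .app a, b, f, g, h => by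
    rw [← fmap_cup_comp_cap f, ← fmap_cup_comp_cap g, linkFunctor_map_injective hp
      (f := cupHom a ≫ fmap f) (g := cupHom a ≫ fmap g)]
    rw [Functor.map_comp, Functor.map_comp, linkFunctor_fmap, linkFunctor_fmap, h]

/-- The source is shortened by the adjunction in `Br p` until it is the generator, where
`Normal.exists_map` applies. This is valid for all `p`, in contrast to injectivity, and it is all
that uniqueness of `R` needs. -/
theorem linkFunctor_map_surjective : ∀ {a b : FreeSSA}
    (u : (linkFunctor p).obj a ⟶ (linkFunctor p).obj b), ∃ f : a ⟶ b, (linkFunctor p).map f = u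
  | .gen, b, u => by
    obtain ⟨k, D, hD⟩ := Br.Hom.exists_scaled u
    obtain ⟨f, hf⟩ := Normal.exists_map p b k D
    exact ⟨f.hom, hf.trans hD.symm⟩
  | .app a, b, u => by
    obtain ⟨f, hf⟩ := linkFunctor_map_surjective (a := a) (b := b.app)
      ((Br.ssa p).adj.homEquiv ((linkFunctor p).obj a) ((linkFunctor p).obj b) u)
    refine ⟨fmap f ≫ capHom b, ?_⟩
    rw [Functor.map_comp, linkFunctor_fmap, hf]
    refine Eq.trans ?_ (((Br.ssa p).adj.homEquiv _ _).symm_apply_apply u)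
    rw [Adjunction.homEquiv_counit]
    rfl

/-- The object with `n` letters `F`. -/
def ofNat : ℕ → FreeSSA
  | 0 => gen
  | n + 1 => (ofNat n).app

theorem linkFunctor_obj_ofNat (n : ℕ) : (linkFunctor p).obj (ofNat n) = ⟨n⟩ := by
  induction n with
  | zero => rfl
  | succ n ih => exact congrArg (fun x : Br p => (⟨x.width + 1⟩ : Br p)) ih

theorem ofNat_linkFunctor_obj (a : FreeSSA) : ofNat ((linkFunctor p).obj a).width = a := by
  induction a with
  | gen => rfl
  | app a ih => exact congrArg app ih

end FreeSSA

/-! ### Inverting and cancelling the functor to diagrams -/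

open FreeSSA in
theorem linkFunctor_isIso {p : ℕ} (hp : 2 ≤ p) : ∃ Θ : Br p ⥤ FreeSSA,
    Θ ⋙ linkFunctor p = 𝟭 (Br p) ∧ linkFunctor p ⋙ Θ = 𝟭 FreeSSA := by
  -- On objects the functor is a bijection with inverse `ofNat`, but the equations hold only
  -- propositionally; hence the arrow `u` is conjugated by `eqToHom` before a preimage is chosen.
  -- Injectivity makes the choice functorial.
  choose g hg using fun (m n : Br p) (u : m ⟶ n) => linkFunctor_map_surjective
    (eqToHom (linkFunctor_obj_ofNat m.width) ≫ u ≫ eqToHom (linkFunctor_obj_ofNat n.width).symm)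
  refine ⟨{
    obj := fun n => ofNat n.width
    map := fun {_ _} u => g _ _ u
    map_id := ?_
    map_comp := ?_ }, ?_, ?_⟩
  · intro n
    apply linkFunctor_map_injective hp
    simp [hg]
  · intro m n q u v
    apply linkFunctor_map_injective hp
    simp [hg]
  · refine CategoryTheory.Functor.ext (fun n => linkFunctor_obj_ofNat n.width) fun m n u => ?_
    simp [hg]
  · refine CategoryTheory.Functor.ext (fun a => ofNat_linkFunctor_obj a) fun a b f => ?_
    apply linkFunctor_map_injective hp
    simp [hg, eqToHom_map]

open FreeSSA in
-- All objects and arrows of `Br p` are in the image of `linkFunctor p`.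
theorem linkFunctor_cancel {p : ℕ} {C : Type*} [Category C] {R S : Br p ⥤ C}
    (h : linkFunctor p ⋙ R = linkFunctor p ⋙ S) : R = S := by
  have hobj : ∀ n : Br p, ∃ a, (linkFunctor p).obj a = n := fun n => ⟨_, linkFunctor_obj_ofNat _⟩
  refine CategoryTheory.Functor.hext (fun n => ?_) fun m n u => ?_
  · obtain ⟨a, rfl⟩ := hobj n
    exact Functor.congr_obj h a
  · obtain ⟨a, rfl⟩ := hobj m
    obtain ⟨b, rfl⟩ := hobj n
    obtain ⟨f, rfl⟩ := linkFunctor_map_surjective u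
    exact Functor.hcongr_hom h f

end BrauerRep

namespace BrauerRep

/-! ### The functor from diagrams to matrices -/

/-- The product of `n` factors `p`, as the functor `p ⊗ _` produces it. -/
def tensorDim (p : ℕ) : ℕ → ℕ
  | 0 => 1
  | n + 1 => p * tensorDim p n

theorem tensorDim_eq (p n : ℕ) : tensorDim p n = p ^ n := by
  induction n with
  | zero => rfl
  | succ n ih => rw [tensorDim, ih, pow_succ']

/-- The sequence with a given number. -/
def tensorSeq (p : ℕ) : ∀ n, Fin (tensorDim p n) ≃ (Fin n → Fin p)
  | 0 => Equiv.ofUnique (Fin 1) (Fin 0 → Fin p)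
  | n + 1 => (splitFin p (tensorDim p n)).trans
      (((Equiv.refl (Fin p)).prodCongr (tensorSeq p n)).trans (Diagram.splitFun p n).symm)

theorem splitFun_tensorSeq (p n : ℕ) (i : Fin (tensorDim p (n + 1))) :
    Diagram.splitFun p n (tensorSeq p (n + 1) i) =
      ((splitFin p (tensorDim p n) i).1, tensorSeq p n (splitFin p (tensorDim p n) i).2) :=
  (Diagram.splitFun p n).apply_symm_apply _

/-- A number below `p * tensorDim p n` is `x + tensorDim p n * a` with `x < tensorDim p n`; so the
leading digit `a` decides, and for equal leading digits the remainder `x`. -/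
theorem tensorSeq_strictMono (p n : ℕ) : StrictMono fun i => toLex (tensorSeq p n i) := by
  induction n with
  | zero => exact fun i j h => absurd h (by rw [Subsingleton.elim (α := Fin 1) i j]; exact lt_irrefl _)
  | succ n ih =>
    intro i j hij
    have hseq : ∀ i : Fin (tensorDim p (n + 1)), tensorSeq p (n + 1) i =
        Fin.cons (splitFin p (tensorDim p n) i).1
          (tensorSeq p n (splitFin p (tensorDim p n) i).2) := fun _ => rfl
    have hval : ∀ i : Fin (tensorDim p (n + 1)), (i : ℕ) =
        (splitFin p (tensorDim p n) i).2 + tensorDim p n * (splitFin p (tensorDim p n) i).1 :=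
      fun i => congrArg Fin.val (finProdFinEquiv.apply_symm_apply i).symm
    have hlt : (i : ℕ) < j := hij
    rw [hval i, hval j] at hlt
    simp only [hseq]
    generalize splitFin p (tensorDim p n) i = x at hlt ⊢
    generalize splitFin p (tensorDim p n) j = y at hlt ⊢
    obtain ⟨a, x⟩ := x
    obtain ⟨b, y⟩ := y
    rcases lt_trichotomy a b with hab | rfl | hab
    · exact ⟨0, fun k hk => absurd hk (Fin.not_lt_zero k), hab⟩
    · obtain ⟨k, hk, hk'⟩ := ih (show x < y from Nat.lt_of_add_lt_add_right hlt)
      refine ⟨k.succ, fun l hl => ?_, hk'⟩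
      cases l using Fin.cases with
      | zero => rfl
      | succ l => exact hk l (Fin.succ_lt_succ_iff.1 hl)
    · exfalso
      have h1 : tensorDim p n * (b + 1) ≤ tensorDim p n * a := Nat.mul_le_mul_left _ hab
      have h2 := y.2
      rw [mul_add, mul_one] at h1
      simp only at hlt
      omega

/-- Both sides come from order isomorphisms of `Fin (p ^ n)` with the lexicographically ordered
sequences, and between well-orders there is at most one. -/
theorem tensorSeq_cast {p n : ℕ} (h : tensorDim p n = p ^ n) (i : Fin (p ^ n)) :
    tensorSeq p n (Fin.cast h.symm i) = digit i := by
  let f : Fin (p ^ n) ≃o Lex (Fin n → Fin p) :=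
    StrictMono.orderIsoOfSurjective (fun i => toLex (tensorSeq p n (Fin.cast h.symm i)))
      (fun _ _ hij => tensorSeq_strictMono p n hij)
      (toLex.surjective.comp ((tensorSeq p n).surjective.comp (finCongr h.symm).surjective))
  exact congrArg (fun g : Fin (p ^ n) ≃o Lex (Fin n → Fin p) => ofLex (g i))
    (Subsingleton.elim f (lexSeq p n))

section

variable (K : Type u) [Field K] (p : ℕ)

/-- The 0/1-matrix of accepted labellings, in terms of the numbers of sequences. -/
def labelMatrix {m n : ℕ} (D : Diagram m n) :
    Matrix (Fin (tensorDim p n)) (Fin (tensorDim p m)) K :=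
  fun j i => if D.Accepts (tensorSeq p m i) (tensorSeq p n j) then 1 else 0

theorem labelMatrix_eq_colM {m n : ℕ} (D : Diagram m n) : labelMatrix K p D =
    ((Diagram.colM p D).map (Nat.cast : ℕ → K)).submatrix (tensorSeq p n) (tensorSeq p m) := by
  ext j i
  simp [labelMatrix, Diagram.colM]

theorem labelMatrix_one (n : ℕ) : labelMatrix K p (Diagram.one n) = 1 := by
  rw [labelMatrix_eq_colM, Diagram.colM_one]
  ext j i
  simp [Matrix.one_apply]

/-- The count of labellings of the middle row in `Diagram.colM_mul`, with natural numbers cast to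
`K`. -/
theorem labelMatrix_mul {m n q : ℕ} (D : Diagram m n) (E : Diagram n q) :
    labelMatrix K p E * labelMatrix K p D =
      (p : K) ^ Diagram.circles D E • labelMatrix K p (D.comp E) := by
  rw [labelMatrix_eq_colM, labelMatrix_eq_colM, Matrix.submatrix_mul_equiv, labelMatrix_eq_colM]
  ext j i
  have h := congrArg (Nat.cast : ℕ → K) (congrFun (congrFun (Diagram.colM_mul p D E)
    (tensorSeq p q j)) (tensorSeq p m i))
  simpa [Matrix.mul_apply] using h

/-- The functor that maps an `m`-`n`-diagram to the 0/1-matrix of accepted labellings. -/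
noncomputable def diagFunctor : Br p ⥤ MatCat K where
  obj n := ⟨tensorDim p n.width⟩
  map f := ((f.coeff : K) • labelMatrix K p f.diag : Matrix _ _ K)
  map_id n := by
    change ((p ^ 0 : ℕ) : K) • labelMatrix K p (Diagram.one n.width) = 1
    rw [labelMatrix_one, pow_zero, Nat.cast_one, one_smul]
  map_comp {m n q} f g := by
    change ((p ^ Diagram.circles f.diag g.diag * (f.coeff * g.coeff) : ℕ) : K) •
      labelMatrix K p (f.diag.comp g.diag) =
      ((g.coeff : K) • labelMatrix K p g.diag) * ((f.coeff : K) • labelMatrix K p f.diag)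
    rw [Matrix.smul_mul, Matrix.mul_smul, labelMatrix_mul, smul_smul, smul_smul]
    congr 1
    push_cast
    ring

theorem labelMatrix_pad {m n : ℕ} (D : Diagram m n) : labelMatrix K p D.pad =
    padM (X := Fin) (s := fun n => p * n) (splitFin p) (tensorDim p m) (tensorDim p n)
      (labelMatrix K p D) := by
  rw [labelMatrix_eq_colM, Diagram.colM_pad]
  ext j i
  simp [padM, splitFun_tensorSeq, labelMatrix_eq_colM]

theorem padM_smul {R Q O : Type*} [CommSemiring R] [DecidableEq Q] {X : O → Type*} {s : O → O}
    (e : ∀ o, X (s o) ≃ Q × X o) (m n : O) (c : R) (M : Matrix (X n) (X m) R) :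
    padM e m n (c • M) = c • padM e m n M := by
  ext j i
  simp [padM]

theorem labelMatrix_cap (n : ℕ) : labelMatrix K p (Diagram.cap n) =
    capM (X := Fin) (s := fun n => p * n) K (splitFin p) (tensorDim p n) := by
  rw [labelMatrix_eq_colM, Diagram.colM_cap]
  ext j i
  simp [capM, splitFun_tensorSeq]
  rfl

theorem labelMatrix_cup (n : ℕ) : labelMatrix K p (Diagram.cup n) =
    cupM (X := Fin) (s := fun n => p * n) K (splitFin p) (tensorDim p n) := by
  rw [labelMatrix_eq_colM, Diagram.colM_cup]
  ext j i
  simp [cupM, splitFun_tensorSeq]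
  rfl

theorem labelMatrix_cross (n : ℕ) : labelMatrix K p (Diagram.cross n) =
    swapM (X := Fin) (s := fun n => p * n) K (splitFin p) (tensorDim p n) := by
  rw [labelMatrix_eq_colM, Diagram.colM_cross]
  ext j i
  simp [swapM, splitFun_tensorSeq]
  rfl

theorem diagFunctor_map_ofDiagram {m n : ℕ} (D : Diagram m n) :
    (diagFunctor K p).map (Br.ofDiagram p D) = labelMatrix K p D := by
  change ((p ^ 0 : ℕ) : K) • labelMatrix K p D = _
  rw [pow_zero, Nat.cast_one, one_smul]

theorem diagFunctor_isStrict : IsStrict (Br.ssa p) (matSSA K p) (diagFunctor K p) where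
  comm := by
    -- Because `tensorDim` follows the recursion of `p ⊗ _`, the objects agree definitionally and
    -- only equations of matrices remain.
    refine CategoryTheory.Functor.hext (fun _ => rfl) fun m n f => heq_of_eq ?_
    refine Eq.trans ?_ (tensorLeft_map K p ((diagFunctor K p).map f)).symm
    change (f.coeff : K) • labelMatrix K p f.diag.pad =
      padM (X := Fin) (s := fun n => p * n) (splitFin p) (tensorDim p m.width)
        (tensorDim p n.width) ((f.coeff : K) • labelMatrix K p f.diag)
    rw [labelMatrix_pad]
    exact (padM_smul (X := Fin) (s := fun n => p * n) (splitFin p) _ _ _ _).symm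
  map_φ n := heq_of_eq ((diagFunctor_map_ofDiagram K p _).trans (labelMatrix_cap K p n.width))
  map_γ n := heq_of_eq ((diagFunctor_map_ofDiagram K p _).trans (labelMatrix_cup K p n.width))
  map_χ n := heq_of_eq ((diagFunctor_map_ofDiagram K p _).trans (labelMatrix_cross K p n.width))

/-- Strict functors compose, and the generator goes to `tensorDim p 0`, which is 1; so freeness
identifies the composite. -/
theorem linkFunctor_comp_diagFunctor : linkFunctor p ⋙ diagFunctor K p = matFunctor K p := by
  refine FreeSSA.eq_lift (matSSA K p) _ _ ⟨?_, fun a => ?_, fun a => ?_, fun a => ?_⟩ rfl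
  · exact (congrArg (fun H => H ⋙ diagFunctor K p) (FreeSSA.lift_comm (Br.ssa p) _)).trans
      (congrArg (fun H => linkFunctor p ⋙ H) (diagFunctor_isStrict K p).comm)
  · exact (diagFunctor_isStrict K p).map_φ ((linkFunctor p).obj a)
  · exact (diagFunctor_isStrict K p).map_γ ((linkFunctor p).obj a)
  · exact (diagFunctor_isStrict K p).map_χ ((linkFunctor p).obj a)

theorem matrixOf_diagFunctor (hR : ∀ n, ((diagFunctor K p).obj ⟨n⟩).dim = p ^ n) {m n : ℕ}
    (f : (⟨m⟩ : Br p) ⟶ ⟨n⟩) (j : Fin (p ^ n)) (i : Fin (p ^ m)) :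
    matrixOf (diagFunctor K p) hR f j i =
      (f.coeff : K) * if f.diag.Accepts (digit i) (digit j) then 1 else 0 := by
  change (f.coeff : K) * labelMatrix K p f.diag (Fin.cast (hR n).symm j)
    (Fin.cast (hR m).symm i) = _
  rw [labelMatrix, tensorSeq_cast (hR n) j, tensorSeq_cast (hR m) i]

end

theorem matrixOf_comp {K : Type u} [Field K] {p : ℕ} (R : Br p ⥤ MatCat K)
    (hR : ∀ n, (R.obj ⟨n⟩).dim = p ^ n) {m n q : ℕ} (f : (⟨m⟩ : Br p) ⟶ ⟨n⟩)
    (g : (⟨n⟩ : Br p) ⟶ ⟨q⟩) : matrixOf R hR (f ≫ g) = matrixOf R hR g * matrixOf R hR f := by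
  unfold matrixOf
  rw [R.map_comp]
  simp only [Matrix.reindex_apply, Matrix.submatrix_mul_equiv]
  rfl

theorem matrixOf_one {K : Type u} [Field K] {p : ℕ} (R : Br p ⥤ MatCat K)
    (hR : ∀ n, (R.obj ⟨n⟩).dim = p ^ n) (n : ℕ) :
    matrixOf R hR (Br.ofDiagram p (Diagram.one n)) = 1 := by
  unfold matrixOf
  have h : R.map (Br.ofDiagram p (Diagram.one n)) =
      (1 : Matrix (Fin (R.obj ⟨n⟩).dim) (Fin (R.obj ⟨n⟩).dim) K) := R.map_id ⟨n⟩
  rw [h, Matrix.reindex_apply]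
  exact Matrix.submatrix_one_equiv _

end BrauerRep

namespace BrauerRep

/-! ### Invariants and extracted matrices -/

/-- A product, over the pairs of an involution without fixed points, of sums of products. -/
theorem prod_pairs_eq_sum {V C K : Type*} [Fintype V] [DecidableEq V] [Fintype C] [DecidableEq C]
    [CommSemiring K] (link : V → V) (hlink : ∀ x, link (link x) = x) (hne : ∀ x, link x ≠ x)
    (z : V → C → K) :
    ∏ t ∈ Finset.univ.image fun x => s(x, link x), Sym2.lift
      ⟨fun a b => dotProduct (z a) (z b), fun _ _ => dotProduct_comm _ _⟩ t =
    ∑ l : V → C, if ∀ x, l (link x) = l x then ∏ x, z x (l x) else 0 := by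
  set T := Finset.univ.image fun x => s(x, link x) with hT
  let thread : V → T := fun x => ⟨s(x, link x), Finset.mem_image_of_mem _ (Finset.mem_univ x)⟩
  have hthread : ∀ x, thread (link x) = thread x := fun x => Subtype.ext (by
    simp [thread, hlink, Sym2.eq_swap])
  have hfib : ∀ a x, thread x = thread a ↔ x = a ∨ x = link a := by
    intro a x
    simp only [thread, Subtype.mk.injEq, Sym2.eq_iff]
    constructor
    · rintro (h | h)
      · exact .inl h.1
      · exact .inr h.1
    · rintro (rfl | rfl)
      · exact .inl ⟨rfl, rfl⟩
      · exact .inr ⟨rfl, hlink a⟩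
  have hsurj : ∀ t : T, ∃ a, thread a = t := by
    rintro ⟨t, ht⟩
    obtain ⟨a, -, rfl⟩ := Finset.mem_image.1 ht
    exact ⟨a, rfl⟩
  have hprod : ∀ g : V → C → K, ∀ f : T → C,
      ∏ x, g x (f (thread x)) = ∏ t : T, ∏ x with thread x = t, g x (f t) := by
    intro g f
    rw [← Finset.prod_fiberwise Finset.univ thread]
    refine Finset.prod_congr rfl fun t _ => Finset.prod_congr rfl fun x hx => ?_
    rw [(Finset.mem_filter.1 hx).2]
  have hpair : ∀ (g : V → K) (a : V), ∏ x with thread x = thread a, g x = g a * g (link a) := by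
    intro g a
    have : (Finset.univ.filter fun x => thread x = thread a) = {a, link a} := by
      ext x
      simp [hfib]
    rw [this, Finset.prod_pair (hne a).symm]
  calc ∏ t ∈ T, Sym2.lift ⟨fun a b => dotProduct (z a) (z b), fun _ _ => dotProduct_comm _ _⟩ t
      = ∏ t : T, ∑ c : C, ∏ x with thread x = t, z x c := by
        rw [← Finset.prod_coe_sort]
        refine Finset.prod_congr rfl fun t _ => ?_
        obtain ⟨a, rfl⟩ := hsurj t
        simp only [hpair (fun x => z x _)]
        rfl
    _ = ∑ f : T → C, ∏ t : T, ∏ x with thread x = t, z x (f t) := by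
        -- Distributivity: a term of the expanded product is a choice of one index for each thread.
        rw [Finset.prod_univ_sum, Fintype.piFinset_univ]
    _ = ∑ f : T → C, ∏ x, z x (f (thread x)) := by simp only [hprod z]
    _ = ∑ l : V → C with ∀ x, l (link x) = l x, ∏ x, z x (l x) := by
        -- Functions on threads are the same as labellings of vertices that agree on linked
        -- vertices. For the inverse, `r` chooses one end of each thread, and the labelling does not
        -- depend on which.
        refine Finset.sum_bij (fun f _ => fun x => f (thread x)) ?_ ?_ ?_ ?_
        · intro f _
          simp [hthread]
        · intro f _ g _ h
          funext t
          obtain ⟨a, rfl⟩ := hsurj t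
          exact congrFun h a
        · intro l hl
          have hl' := (Finset.mem_filter.1 hl).2
          choose r hr using hsurj
          refine ⟨fun t => l (r t), Finset.mem_univ _, funext fun x => ?_⟩
          rcases (hfib x (r (thread x))).1 (hr _) with h | h
          · exact congrArg l h
          · exact (congrArg l h).trans (hl' x)
        · intro f _
          rfl
    _ = _ := by rw [Finset.sum_filter]

/-- Sequences by number. -/
noncomputable def digitEquiv (p n : ℕ) : Fin (p ^ n) ≃ (Fin n → Fin p) :=
  (lexSeq p n).toEquiv.trans ofLex

namespace Diagram

variable {K : Type u} [Field K] {p n : ℕ}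

/-- In the expansion `prod_pairs_eq_sum` a labelling of all vertices is a pair of sequences, one for
each row, and its condition is that the pair accepts `D`. -/
theorem isExtracted_brauerMatrix (D : Diagram n n) : D.IsExtracted (D.brauerMatrix K p) := by
  intro x y
  have h : D.invariant x y = _ := prod_pairs_eq_sum D.link D.link_link D.link_ne (Sum.elim x y)
  rw [h, ← (Equiv.sumArrowEquivProdArrow (Fin n) (Fin n) (Fin p)).symm.sum_comp,
    Fintype.sum_prod_type, ← (digitEquiv p n).sum_comp]
  refine Finset.sum_congr rfl fun i _ => ?_
  rw [← (digitEquiv p n).sum_comp]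
  refine Finset.sum_congr rfl fun j _ => ?_
  simp only [brauerMatrix, ite_mul, one_mul, zero_mul, Fintype.prod_sum_type]
  rfl

/-- With standard basis vectors chosen according to the digits of `i'` and `j'`, all monomials
vanish except the one with coefficient `b i' j'`. -/
theorem IsExtracted.eq {D : Diagram n n} {b c : Matrix (Fin (p ^ n)) (Fin (p ^ n)) K}
    (hb : D.IsExtracted b) (hc : D.IsExtracted c) : b = c := by
  have key : ∀ (b : Matrix (Fin (p ^ n)) (Fin (p ^ n)) K) (i' j' : Fin (p ^ n)),
      ∑ i, ∑ j, b i j * (∏ k, (Pi.single (digit i' k) 1 : Fin p → K) (digit i k)) *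
        ∏ k, (Pi.single (digit j' k) 1 : Fin p → K) (digit j k) = b i' j' := by
    intro b i' j'
    have hdelta : ∀ i' i : Fin (p ^ n),
        (∏ k, (Pi.single (digit i' k) 1 : Fin p → K) (digit i k)) = if i = i' then 1 else 0 := by
      intro i' i
      split_ifs with h
      · simp [h]
      · obtain ⟨k, hk⟩ := Function.ne_iff.1 ((digitEquiv p n).injective.ne h)
        exact Finset.prod_eq_zero (Finset.mem_univ k) (Pi.single_eq_of_ne hk 1)
    simp [hdelta]
  ext i j
  rw [← key b i j, ← key c i j, ← hb (fun k => Pi.single (digit i k) 1) fun k =>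
    Pi.single (digit j k) 1, ← hc]

theorem isExtracted_iff (D : Diagram n n) (b : Matrix (Fin (p ^ n)) (Fin (p ^ n)) K) :
    D.IsExtracted b ↔ b = D.brauerMatrix K p :=
  ⟨fun h => h.eq D.isExtracted_brauerMatrix, fun h => h ▸ D.isExtracted_brauerMatrix⟩

end Diagram

/-! ### The representation of Brauer's algebra -/

theorem matrixOf_scaled {K : Type u} [Field K] {p : ℕ}
    (hR : ∀ n, ((diagFunctor K p).obj ⟨n⟩).dim = p ^ n) {m n : ℕ} (k : ℕ) (D : Diagram m n) :
    matrixOf (diagFunctor K p) hR (Br.scaled p k D) =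
      (p : K) ^ k • matrixOf (diagFunctor K p) hR (Br.ofDiagram p D) := by
  ext j i
  rw [Matrix.smul_apply, matrixOf_diagFunctor, matrixOf_diagFunctor, smul_eq_mul]
  change ((p ^ k : ℕ) : K) * _ = (p : K) ^ k * (((p ^ 0 : ℕ) : K) * _)
  rw [pow_zero, Nat.cast_one, one_mul, Nat.cast_pow]
  rfl

theorem matrixOf_ofDiagram {K : Type u} [Field K] {p : ℕ}
    (hR : ∀ n, ((diagFunctor K p).obj ⟨n⟩).dim = p ^ n) {n : ℕ} (D : Diagram n n) :
    matrixOf (diagFunctor K p) hR (Br.ofDiagram p D) = (D.brauerMatrix K p).transpose := by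
  ext j i
  rw [matrixOf_diagFunctor]
  change ((p ^ 0 : ℕ) : K) * _ = _
  rw [pow_zero, Nat.cast_one, one_mul]
  rfl

theorem ofDiagram_comp {p m n q : ℕ} (D : Diagram m n) (E : Diagram n q) :
    Br.ofDiagram p D ≫ Br.ofDiagram p E = Br.scaled p (Diagram.circles D E) (D.comp E) :=
  Br.scaled_comp 0 0 D E

/-- The representation of Brauer's algebra by transposed Brauer matrices. -/
noncomputable def brauerHom (K : Type u) [Field K] (p n : ℕ) :
    BrauerAlgebra K p n →ₐ[K] Matrix (Fin (p ^ n)) (Fin (p ^ n)) K :=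
  AlgHom.ofLinearMap
    ((Matrix.transposeLinearEquiv (Fin (p ^ n)) (Fin (p ^ n)) K K).toLinearMap ∘ₗ brauerMap K p n)
    (by
      have hR : ∀ n, ((diagFunctor K p).obj ⟨n⟩).dim = p ^ n := tensorDim_eq p
      change (brauerMap K p n (BrauerAlgebra.basis K p n (Diagram.one n))).transpose = 1
      rw [brauerMap, Module.Basis.constr_basis, ← matrixOf_ofDiagram hR, matrixOf_one])
    (by
      have hR : ∀ n, ((diagFunctor K p).obj ⟨n⟩).dim = p ^ n := tensorDim_eq p
      intro x y
      change (brauerMap K p n (BrauerAlgebra.mulMap K p n x y)).transpose =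
        (brauerMap K p n x).transpose * (brauerMap K p n y).transpose
      -- By bilinearity two diagrams suffice. Their transposed Brauer matrices are values of
      -- `diagFunctor`, so the claim is functoriality, the circles giving the same power of `p` on
      -- both sides.
      induction x using BrauerAlgebra.basis_induction with
      | zero => simp
      | add _ _ h h' => simp [h, h', add_mul]
      | smul _ _ h => simp [h]
      | single E =>
      induction y using BrauerAlgebra.basis_induction with
      | zero => simp
      | add _ _ h h' => simp [h, h', mul_add]
      | smul _ _ h => simp [h]
      | single D =>
      rw [BrauerAlgebra.mulMap_basis, map_smul, Matrix.transpose_smul, brauerMap,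
        Module.Basis.constr_basis, Module.Basis.constr_basis, Module.Basis.constr_basis,
        ← matrixOf_ofDiagram hR, ← matrixOf_ofDiagram hR, ← matrixOf_ofDiagram hR,
        ← matrixOf_comp, ofDiagram_comp, matrixOf_scaled])

end BrauerRep

theorem mainTheorem1 {K : Type*} [Field K] (p : ℕ) (hp : 1 ≤ p) :
    (2 ≤ p → ∃ Θ : Br p ⥤ FreeSSA, Θ ⋙ linkFunctor p = 𝟭 (Br p) ∧
      linkFunctor p ⋙ Θ = 𝟭 FreeSSA) ∧
    ∃ R : Br p ⥤ MatCat K,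
      (∀ R' : Br p ⥤ MatCat K, linkFunctor p ⋙ R' = matFunctor K p ↔ R' = R) ∧
      (∀ Θ : Br p ⥤ FreeSSA, Θ ⋙ linkFunctor p = 𝟭 (Br p) → linkFunctor p ⋙ Θ = 𝟭 FreeSSA →
        R = Θ ⋙ matFunctor K p) ∧
      ∃ hR : ∀ n, (R.obj ⟨n⟩).dim = p ^ n,
        (∀ (m n q : ℕ) (D₁ : Diagram m n) (D₂ : Diagram n q),
          matrixOf R hR (Br.ofDiagram p D₁ ≫ Br.ofDiagram p D₂) =
            matrixOf R hR (Br.ofDiagram p D₂) * matrixOf R hR (Br.ofDiagram p D₁)) ∧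
        (∀ (m n k : ℕ) (D : Diagram m n),
          matrixOf R hR (Br.scaled p k D) = (p : K) ^ k • matrixOf R hR (Br.ofDiagram p D)) ∧
        (∀ (n : ℕ) (D : Diagram n n),
          matrixOf R hR (Br.ofDiagram p D) = (D.brauerMatrix K p).transpose ∧
          ∀ b, D.IsExtracted b ↔ b = D.brauerMatrix K p) ∧
        ∀ n : ℕ, ∃ ρ : BrauerAlgebra K p n →ₐ[K] Matrix (Fin (p ^ n)) (Fin (p ^ n)) K,
          (∀ D, ρ (BrauerAlgebra.basis K p n D) = matrixOf R hR (Br.ofDiagram p D)) ∧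
          ∀ x, ρ x = (brauerMap K p n x).transpose := by
  have hR : ∀ n, ((diagFunctor K p).obj ⟨n⟩).dim = p ^ n := tensorDim_eq p
  refine ⟨linkFunctor_isIso, diagFunctor K p, fun R' => ⟨fun h => ?_, ?_⟩, fun Θ h _ => ?_, hR,
    fun m n q D₁ D₂ => matrixOf_comp _ hR _ _, fun m n k D => matrixOf_scaled hR k D,
    fun n D => ⟨matrixOf_ofDiagram hR D, D.isExtracted_iff⟩,
    fun n => ⟨brauerHom K p n, fun D => ?_, fun _ => rfl⟩⟩
  · exact linkFunctor_cancel (h.trans (linkFunctor_comp_diagFunctor K p).symm)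
  · rintro rfl
    exact linkFunctor_comp_diagFunctor K p
  -- Any right inverse `Θ` of `linkFunctor p` cancels against it in `Θ ⋙ linkFunctor p ⋙ diagFunctor
  -- K p`.
  · rw [← linkFunctor_comp_diagFunctor]
    exact (congrArg (fun H => H ⋙ diagFunctor K p) h).symm
  · rw [matrixOf_ofDiagram]
    exact congrArg Matrix.transpose ((BrauerAlgebra.basis K p n).constr_basis K _ D)
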